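/- Let $L=\{L(t)\}_{t\in\mathbb R}$ be Cauchy motion on a probability space: $L(0)=0$ almost surely, $L$ has independent increments, and $L(t)-L(s)$ has the Cauchy distribution $C(0,|t-s|)$ with location $0$ and scale $|t-s|$ for all $s,t$. For a function $h$ on $[0,1]$, the stochastic integral $\int_0^1 h(z)\,dL(z)$ is the limit in probability of the sums $\sum_i c_i\,(L(t_{i+1})-L(t_i))$ taken along step functions $\sum_i c_i 1_{(t_i,t_{i+1}]}$ on $(0,1]$ that converge to $h$ in $L^1(0,1)$. Then the integrals $$X_1=\int_0^1 1\,dL(z),\qquad X_2=\int_0^1 z\,dL(z)$$ exist, and the random vector $(X_1,X_2)$ has a (unique) continuous density $f\ge 0$ with respect to Lebesgue measure on $\mathbb R^2$. With $Q=1-2ix_1+x_1^2+4ix_2$, it is given for $x_1\neq 2x_2$ by $$f(x_1,x_2)=\frac{4/\pi^2}{1+6x_1^2+x_1^4-16x_1x_2+16x_2^2}+\frac{2}{\pi^2}\,\Re\left(\frac{\operatorname{atan}\bigl(i\sqrt{Q}/(x_1-2x_2)\bigr)}{Q^{3/2}}\right),$$ and for $x_1=2x_2$ by $$f(x_1,x_2)=\frac{4/\pi^2}{(1+x_1^2)^2}+\frac{1}{\pi(1+x_1^2)^{3/2}}.$$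 Here $\sqrt Q$ and $Q^{3/2}$ are principal values (note $\Re Q=1+x_1^2>0$) and $\operatorname{atan}(z)=\frac{i}{2}\bigl(\ln(1-iz)-\ln(1+iz)\bigr)$ with the principal logarithm. -/

import Mathlib

open MeasureTheory ProbabilityTheory Filter Topology

/-- Cauchy motion (two-sided symmetric `1`-stable Lévy motion) on the probability space `(Ω, P)`:
`L 0 = 0` almost surely, the increments over successive intervals are independent, and
`L t - L s` has the Cauchy distribution `C(0, |t - s|)` with location `0` and scale `|t - s|`
(the Dirac mass at `0` when `t = s`). -/
structure IsCauchyMotion {Ω : Type*} [MeasurableSpace Ω] (P : Measure Ω) (L : ℝ → Ω → ℝ) :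
    Prop where
  zero : ∀ᵐ ω ∂P, L 0 ω = 0
  indep : HasIndepIncrements L P
  law : ∀ s t : ℝ, HasLaw (fun ω => L t ω - L s ω) (cauchyMeasure 0 (Real.nnabs (t - s))) P

/-- A step function on `(a, b]`: it takes the value `coef i` on `(node i, node (i + 1)]` for
`i < n`, where `a ≤ node 0 ≤ node 1 ≤ ⋯ ≤ b`, and is `0` elsewhere. -/
structure StepFun (a b : ℝ) where
  /-- The number of pieces. -/
  n : ℕ
  /-- The subdivision points. -/
  node : ℕ → ℝ
  /-- The values on the pieces. -/
  coef : ℕ → ℝ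
  mono : Monotone node
  mem : ∀ i, node i ∈ Set.Icc a b

namespace StepFun

/-- The step function as a function on the line. -/
noncomputable def toFun {a b : ℝ} (g : StepFun a b) (x : ℝ) : ℝ :=
  ∑ i ∈ Finset.range g.n, (Set.Ioc (g.node i) (g.node (i + 1))).indicator (fun _ => g.coef i) x

/-- The elementary stochastic integral `∑ cᵢ (L(tᵢ₊₁) - L(tᵢ))` of a step function. -/
def integral {a b : ℝ} {Ω : Type*} (g : StepFun a b) (L : ℝ → Ω → ℝ) (ω : Ω) : ℝ :=
  ∑ i ∈ Finset.range g.n, g.coef i * (L (g.node (i + 1)) ω - L (g.node i) ω)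

end StepFun

/-- The random variable `Y` is (a version of) the stochastic integral `∫_a^b f dL` of the
deterministic function `f`: it is the limit in probability of the elementary integrals of step
functions that converge to `f` in `L¹` on `(a, b]`. -/
def IsStochIntegral {Ω : Type*} [MeasurableSpace Ω] (P : Measure Ω) (L : ℝ → Ω → ℝ)
    (a b : ℝ) (f : ℝ → ℝ) (Y : Ω → ℝ) : Prop :=
  AEMeasurable Y P ∧
    ∃ g : ℕ → StepFun a b,
      Tendsto (fun k => eLpNorm (fun x => f x - (g k).toFun x) 1 (volume.restrict (Set.Ioc a b)))
        atTop (𝓝 0) ∧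
      TendstoInMeasure P (fun k => (g k).integral L) atTop Y

/-- The complex number `Q = 1 - 2 i x₁ + x₁² + 4 i x₂`, whose real part is at least `1`. -/
noncomputable def cauchyQ (x₁ x₂ : ℝ) : ℂ :=
  1 - 2 * Complex.I * x₁ + (x₁ : ℂ) ^ 2 + 4 * Complex.I * x₂

/-! For a step function the elementary integral is a sum of independent Cauchy variables, so `u X₁ +
v X₂` is symmetric Cauchy with scale the `L¹` norm of `u f₁ + v f₂` (`charFun_combination`). This
passes to limits in probability, and the characteristic function of `(X₁, X₂)` is `exp (-N(u, v))`
with `N(u, v) = ∫₀¹ |u + v y| dy` (`affineNorm`). Existence of the integrals comes from the same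
formula: `L¹` closeness of step functions controls the tails of the difference of their integrals,
and Borel–Cantelli gives almost sure convergence along a fast approximation.

Since `N` dominates a multiple of `|u| + |v|`, the characteristic function is integrable, and
Fourier inversion (`eq_withDensity_charDensity`) gives a continuous nonnegative density. It is
computed by the substitution `v = u w`. As `N` is homogeneous, the `u`-integral is explicit and
leaves the real part of `∫ dw / (N(1, w) - i (x₁ + w x₂))²`. For `w ≥ -1` the norm `N(1, w)` is
affine in `w`. For `w < -1` the substitution `t = -1/w` gives `∫₀¹ dt / q(t)²` with `q` quadratic
(`cauchyQuad`) and `4 q = (2 t - 1 - i x₁)² + Q`, which produces a rational term and two arctangents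
over `Q^(3/2)`.

The arctangents are combined by an addition formula (`arctan_sub_arctan_eq`). It holds modulo `π` by
algebra; the branch is fixed by deforming `(x₁, x₂)` linearly to the origin, along which no branch
cut is met. -/

/-! ### Characteristic function of the Cauchy law -/

open scoped FourierTransform in
/-- The Fourier transform of `exp (-2πγ|x|)` is the Cauchy density of scale `γ`. -/
lemma fourier_exp_neg_abs {γ : NNReal} (hγ : γ ≠ 0) (w : ℝ) :
    𝓕 (fun x : ℝ => Complex.exp (-(2 * Real.pi * γ * |x| : ℝ))) w =
      (cauchyPDFReal 0 γ w : ℂ) := by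
  have hγ' : (0 : ℝ) < γ := by positivity
  have hπ := Real.pi_pos
  rw [Real.fourier_real_eq_integral_exp_smul]
  have e1 : ∀ x ∈ Set.Iic (0:ℝ), Complex.exp (↑(-2 * Real.pi * x * w) * Complex.I) •
      Complex.exp (-(2 * Real.pi * γ * |x| : ℝ)) =
      Complex.exp ((2 * Real.pi * (γ - w * Complex.I)) * x) := by
    intro x hx
    rw [abs_of_nonpos hx, smul_eq_mul, ← Complex.exp_add]
    congr 1; push_cast; ring
  have e2 : ∀ x ∈ Set.Ioi (0:ℝ), Complex.exp (↑(-2 * Real.pi * x * w) * Complex.I) •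
      Complex.exp (-(2 * Real.pi * γ * |x| : ℝ)) =
      Complex.exp ((-(2 * Real.pi * (γ + w * Complex.I))) * x) := by
    intro x hx
    rw [abs_of_pos hx, smul_eq_mul, ← Complex.exp_add]
    congr 1; push_cast; ring
  have r1 : 0 < (2 * Real.pi * (γ - w * Complex.I) : ℂ).re := by
    simp; positivity
  have r2 : (-(2 * Real.pi * (γ + w * Complex.I)) : ℂ).re < 0 := by
    simp; positivity
  rw [← intervalIntegral.integral_Iic_add_Ioi (b := 0),
    setIntegral_congr_fun measurableSet_Iic e1, setIntegral_congr_fun measurableSet_Ioi e2,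
    integral_exp_mul_complex_Iic r1, integral_exp_mul_complex_Ioi r2]
  · have n1 : (γ - w * Complex.I : ℂ) ≠ 0 := by
      intro h; have := congrArg Complex.re h; simp at this; exact hγ this
    have n2 : (γ + w * Complex.I : ℂ) ≠ 0 := by
      intro h; have := congrArg Complex.re h; simp at this; exact hγ this
    have n3 : (w ^ 2 + γ ^ 2 : ℂ) ≠ 0 := by
      have : (w ^ 2 + γ ^ 2 : ℂ) = (γ - w * Complex.I) * (γ + w * Complex.I) := by
        ring_nf; simp
      rw [this]; exact mul_ne_zero n1 n2
    have hπ' : (Real.pi : ℂ) ≠ 0 := by exact_mod_cast hπ.ne'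
    rw [cauchyPDFReal_def]
    push_cast
    simp only [sub_zero, mul_zero, Complex.exp_zero]
    field_simp
    ring_nf
    simp only [Complex.I_sq]
    ring
  · exact (integrableOn_congr_fun e1 measurableSet_Iic).2 (integrableOn_exp_mul_complex_Iic r1 0)
  · exact (integrableOn_congr_fun e2 measurableSet_Ioi).2 (integrableOn_exp_mul_complex_Ioi r2 0)

lemma integrable_exp_neg_mul_abs {c : ℝ} (hc : 0 < c) :
    Integrable (fun x : ℝ => Real.exp (-(c * |x|))) := by
  have e1 : ∀ x ∈ Set.Iic (0:ℝ), Real.exp (-(c * |x|)) = Real.exp (c * x) := by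
    intro x hx
    rw [abs_of_nonpos hx]; congr 1; ring
  have e2 : ∀ x ∈ Set.Ioi (0:ℝ), Real.exp (-(c * |x|)) = Real.exp (-c * x) := by
    intro x hx
    rw [abs_of_pos hx]; congr 1; ring
  rw [← integrableOn_univ, ← Set.Iic_union_Ioi (a := (0:ℝ))]
  exact ((integrableOn_congr_fun e1 measurableSet_Iic).2 (integrableOn_exp_mul_Iic hc 0)).union
    ((integrableOn_congr_fun e2 measurableSet_Ioi).2 (integrableOn_exp_mul_Ioi (by linarith) 0))

open scoped FourierTransform in
/-- The characteristic function of the symmetric Cauchy distribution. -/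
lemma charFun_cauchyMeasure (γ : NNReal) (t : ℝ) :
    charFun (cauchyMeasure 0 γ) t = Complex.exp (-(γ * |t| : ℝ)) := by
  by_cases hγ : γ = 0
  · simp [hγ]
  have hγ' : (0 : ℝ) < γ := by positivity
  have hπ := Real.pi_pos
  set f : ℝ → ℂ := fun x => Complex.exp (-(2 * Real.pi * γ * |x| : ℝ)) with hf
  have hF : 𝓕 f = fun w => (cauchyPDFReal 0 γ w : ℂ) := funext (fourier_exp_neg_abs hγ)
  have fc : Continuous f := by fun_prop
  have fi : Integrable f := by
    refine ((integrable_exp_neg_mul_abs (c := 2 * Real.pi * γ) (by positivity)).ofReal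
      (𝕜 := ℂ)).congr (ae_of_all _ fun x => ?_)
    simp [hf]
  have inv := congrFun (fc.fourierInv_fourier_eq fi
    (by rw [hF]; exact (integrable_cauchyPDFReal 0).ofReal)) (t / (2 * Real.pi))
  rw [hF, Real.fourierInv_eq'] at inv
  rw [charFun_apply_real, cauchyMeasure_of_scale_ne_zero _ hγ,
    integral_withDensity_eq_integral_toReal_smul (measurable_cauchyPDF 0 γ)
      (ae_of_all _ fun x => ENNReal.ofReal_lt_top)]
  have h2 : f (t / (2 * Real.pi)) = Complex.exp (-(γ * |t| : ℝ)) := by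
    simp only [hf, abs_div]
    congr 3
    rw [abs_of_pos (by positivity : (0:ℝ) < 2 * Real.pi)]
    field_simp
  rw [← h2, ← inv]
  refine integral_congr_ae (ae_of_all _ fun x => ?_)
  simp only [cauchyPDF, ENNReal.toReal_ofReal (cauchyPDF_pos 0 hγ x).le, smul_eq_mul,
    Complex.real_smul, mul_comm]
  congr 2
  simp only [RCLike.inner_apply, conj_trivial]
  push_cast
  field_simp

/-! ### Step functions on a common grid -/

lemma exists_monotone_enumeration (T : Finset ℝ) (hT : T.Nonempty) :
    ∃ (N : ℕ) (t : ℕ → ℝ), Monotone t ∧ (∀ j, t j ∈ T) ∧ ∀ x ∈ T, ∃ j ≤ N, t j = x := by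
  have hc : 0 < T.card := hT.card_pos
  refine ⟨T.card - 1, fun j => T.orderEmbOfFin rfl ⟨min j (T.card - 1), by omega⟩, ?_, ?_, ?_⟩
  · intro i j hij
    refine (T.orderEmbOfFin rfl).monotone ?_
    simp only [Fin.mk_le_mk]; omega
  · intro j
    exact T.orderEmbOfFin_mem rfl _
  · intro x hx
    have : x ∈ Set.range (T.orderEmbOfFin rfl) := by simpa using hx
    obtain ⟨k, rfl⟩ := this
    refine ⟨k, by omega, congrArg (T.orderEmbOfFin rfl) (Fin.ext ?_)⟩
    simp only; omega

/-- Telescoping of the increments of `G` over the cells of a grid contained in `(t p, t q]`. -/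
lemma sum_indicator_Ioc_mul_increment {t : ℕ → ℝ} (ht : Monotone t) {N p q : ℕ}
    (hq : q ≤ N) (hpq : t p ≤ t q) (G : ℝ → ℝ) (c : ℝ) :
    ∑ j ∈ Finset.range N, (Set.Ioc (t p) (t q)).indicator (fun _ => c) (t (j + 1)) *
      (G (t (j + 1)) - G (t j)) = c * (G (t q) - G (t p)) := by
  -- Clamping to `[t p, t q]` makes every summand an increment of `c * G ∘ cl`: cells outside the
  -- interval are collapsed to a point.
  set cl : ℝ → ℝ := fun x => max (t p) (min x (t q)) with hcl
  have key : ∀ j ∈ Finset.range N,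
      (Set.Ioc (t p) (t q)).indicator (fun _ => c) (t (j + 1)) * (G (t (j + 1)) - G (t j)) =
        c * G (cl (t (j + 1))) - c * G (cl (t j)) := by
    intro j _
    have hj : t j ≤ t (j + 1) := ht (Nat.le_succ j)
    rcases le_or_gt (t (j + 1)) (t p) with h1 | h1
    · rw [Set.indicator_of_notMem (by simp [h1])]
      simp only [hcl]
      rw [max_eq_left ((min_le_left _ _).trans h1),
        max_eq_left ((min_le_left _ _).trans (hj.trans h1))]
      ring
    · have hpj : t p ≤ t j := ht (by
        by_contra h; exact absurd (ht (show j + 1 ≤ p by omega)) (not_le.2 h1))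
      rcases le_or_gt (t (j + 1)) (t q) with h2 | h2
      · rw [Set.indicator_of_mem (Set.mem_Ioc.2 ⟨h1, h2⟩)]
        simp only [hcl]
        rw [min_eq_left h2, min_eq_left (hj.trans h2), max_eq_right h1.le, max_eq_right hpj]
        ring
      · have hqj : t q ≤ t j := ht (by
          by_contra h; exact absurd (ht (show j + 1 ≤ q by omega)) (not_le.2 h2))
        rw [Set.indicator_of_notMem (by simp [h2])]
        simp only [hcl]
        rw [min_eq_right h2.le, min_eq_right hqj]
        ring
  rw [Finset.sum_congr rfl key, Finset.sum_range_sub (fun j => c * G (cl (t j)))]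
  have h0 : cl (t 0) = t p := by
    simp only [hcl]
    exact max_eq_left ((min_le_left _ _).trans (ht (Nat.zero_le p)))
  have hN : cl (t N) = t q := by
    simp only [hcl]
    rw [min_eq_right (ht hq), max_eq_right hpq]
  rw [h0, hN]; ring

/-- No grid point lies strictly inside a cell, so a cell is either contained in `(t p, t q]` or
disjoint from it, and its right end decides which. -/
lemma mem_Ioc_grid_iff {t : ℕ → ℝ} (ht : Monotone t) {p q j : ℕ} {x : ℝ}
    (hx : x ∈ Set.Ioc (t j) (t (j + 1))) :
    x ∈ Set.Ioc (t p) (t q) ↔ t (j + 1) ∈ Set.Ioc (t p) (t q) := by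
  constructor
  · rintro ⟨h1, h2⟩
    refine ⟨h1.trans_le hx.2, ht ?_⟩
    by_contra h
    exact absurd (hx.1.trans_le h2) (not_lt.2 (ht (by omega)))
  · rintro ⟨h1, h2⟩
    refine ⟨lt_of_le_of_lt (ht ?_) hx.1, hx.2.trans h2⟩
    by_contra h
    exact absurd h1 (not_lt.2 (ht (by omega)))

namespace StepFun

variable {a b : ℝ}

/-- Every subdivision point of `g` occurs among `t 0, …, t N`. -/
def IsSubordinate (g : StepFun a b) (t : ℕ → ℝ) (N : ℕ) : Prop :=
  ∀ i ≤ g.n, ∃ j ≤ N, t j = g.node i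

lemma IsSubordinate.integral_eq {g : StepFun a b} {t : ℕ → ℝ} {N : ℕ}
    (hg : g.IsSubordinate t N) (ht : Monotone t) {Ω : Type*} (L : ℝ → Ω → ℝ) (ω : Ω) :
    g.integral L ω =
      ∑ j ∈ Finset.range N, g.toFun (t (j + 1)) * (L (t (j + 1)) ω - L (t j) ω) := by
  simp only [toFun, Finset.sum_mul]
  rw [Finset.sum_comm, integral]
  refine Finset.sum_congr rfl fun i hi => ?_
  have hi' := Finset.mem_range.1 hi
  obtain ⟨p, -, hp'⟩ := hg i hi'.le
  obtain ⟨q, hq, hq'⟩ := hg (i + 1) hi'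
  have := g.mono (Nat.le_succ i)
  rw [Nat.succ_eq_add_one, ← hp', ← hq'] at this
  rw [← hp', ← hq', sum_indicator_Ioc_mul_increment ht hq this (fun x => L x ω)]

lemma IsSubordinate.toFun_eq {g : StepFun a b} {t : ℕ → ℝ} {N : ℕ}
    (hg : g.IsSubordinate t N) (ht : Monotone t) {j : ℕ} {x : ℝ}
    (hx : x ∈ Set.Ioc (t j) (t (j + 1))) : g.toFun x = g.toFun (t (j + 1)) := by
  refine Finset.sum_congr rfl fun i hi => ?_
  have hi' := Finset.mem_range.1 hi
  obtain ⟨p, -, hp'⟩ := hg i hi'.le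
  obtain ⟨q, hq, hq'⟩ := hg (i + 1) hi'
  rw [← hp', ← hq']
  by_cases h : x ∈ Set.Ioc (t p) (t q)
  · rw [Set.indicator_of_mem h, Set.indicator_of_mem ((mem_Ioc_grid_iff ht hx).1 h)]
  · rw [Set.indicator_of_notMem h,
      Set.indicator_of_notMem (fun h' => h ((mem_Ioc_grid_iff ht hx).2 h'))]

lemma exists_common_grid (g h : StepFun a b) :
    ∃ (N : ℕ) (t : ℕ → ℝ), Monotone t ∧ t 0 = a ∧ t N = b ∧
      g.IsSubordinate t N ∧ h.IsSubordinate t N := by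
  classical
  have hab : a ≤ b := (g.mem 0).1.trans (g.mem 0).2
  -- The end points are included so that the cells fill all of `(a, b]`, also where both step
  -- functions vanish.
  set T : Finset ℝ := {a, b} ∪ (Finset.range (g.n + 1)).image g.node ∪
    (Finset.range (h.n + 1)).image h.node with hT
  have hTab : ∀ x ∈ T, x ∈ Set.Icc a b := by
    intro x hx
    simp only [hT, Finset.mem_union, Finset.mem_insert, Finset.mem_singleton,
      Finset.mem_image] at hx
    rcases hx with ((rfl | rfl) | ⟨i, -, rfl⟩) | ⟨i, -, rfl⟩
    · exact ⟨le_rfl, hab⟩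
    · exact ⟨hab, le_rfl⟩
    · exact g.mem i
    · exact h.mem i
  obtain ⟨N, t, ht, htT, hN⟩ := exists_monotone_enumeration T ⟨a, by simp [hT]⟩
  refine ⟨N, t, ht, ?_, ?_, ?_, ?_⟩
  · obtain ⟨j, -, hj⟩ := hN a (by simp [hT])
    exact le_antisymm (hj ▸ ht (Nat.zero_le j)) (hTab _ (htT 0)).1
  · obtain ⟨j, hjN, hj⟩ := hN b (by simp [hT])
    exact le_antisymm (hTab _ (htT N)).2 (by rw [← hj]; exact ht hjN)
  · intro i hi
    exact hN _ (by simp only [hT, Finset.mem_union, Finset.mem_image, Finset.mem_range]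
                   exact Or.inl (Or.inr ⟨i, by omega, rfl⟩))
  · intro i hi
    exact hN _ (by simp only [hT, Finset.mem_union, Finset.mem_image, Finset.mem_range]
                   exact Or.inr ⟨i, by omega, rfl⟩)

lemma integrable_toFun (g : StepFun a b) : Integrable g.toFun :=
  integrable_finsetSum _ fun _ _ =>
    (integrable_indicator_iff measurableSet_Ioc).2 (integrableOn_const (by simp))

/-- The integrand is constant on each cell. The resulting sum is the exponent that independence of
the increments produces in `charFun_combination`. -/
lemma setIntegral_abs_combination (g h : StepFun a b) {t : ℕ → ℝ} {N : ℕ} (ht : Monotone t)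
    (h0 : t 0 = a) (hN : t N = b) (hg : g.IsSubordinate t N) (hh : h.IsSubordinate t N)
    (u v : ℝ) :
    ∫ x in Set.Ioc a b, |u * g.toFun x + v * h.toFun x| =
      ∑ j ∈ Finset.range N,
        |u * g.toFun (t (j + 1)) + v * h.toFun (t (j + 1))| * (t (j + 1) - t j) := by
  have hi : Integrable (fun x => |u * g.toFun x + v * h.toFun x|) :=
    ((g.integrable_toFun.const_mul u).add (h.integrable_toFun.const_mul v)).abs
  have split : ∀ f : ℝ → ℝ, Integrable f → ∫ x in a..b, f x =
      ∑ j ∈ Finset.range N, ∫ x in t j..t (j + 1), f x := fun f hf => by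
    rw [intervalIntegral.sum_integral_adjacent_intervals (fun _ _ => hf.intervalIntegrable),
      h0, hN]
  rw [← intervalIntegral.integral_of_le (by rw [← h0, ← hN]; exact ht (Nat.zero_le N)),
    split _ hi]
  refine Finset.sum_congr rfl fun j _ => ?_
  rw [intervalIntegral.integral_of_le (ht (Nat.le_succ j)),
    setIntegral_congr_fun (g := fun _ => |u * g.toFun (t (j + 1)) + v * h.toFun (t (j + 1))|)
      measurableSet_Ioc (fun x hx => by simp only [hg.toFun_eq ht hx, hh.toFun_eq ht hx])]
  simp [ht (Nat.le_succ j), mul_comm]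

end StepFun

/-! ### Laws and existence of stochastic integrals -/

namespace IsCauchyMotion

variable {Ω : Type*} [MeasurableSpace Ω] {P : Measure Ω} {L : ℝ → Ω → ℝ}

lemma aemeasurable_integral (hL : IsCauchyMotion P L) {a b : ℝ} (g : StepFun a b) :
    AEMeasurable (g.integral L) P :=
  Finset.aemeasurable_fun_sum _ fun _ _ => (hL.law _ _).aemeasurable.const_mul _

lemma charFun_increment (hL : IsCauchyMotion P L) (s t c x : ℝ) :
    charFun (P.map (fun ω => c * (L t ω - L s ω))) x =
      Complex.exp (-(|x| * (|c| * |t - s|) : ℝ)) := by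
  have h := hL.law s t
  have : P.map (fun ω => c * (L t ω - L s ω)) =
      (cauchyMeasure 0 (Real.nnabs (t - s))).map (fun y => c * y) := by
    rw [← h.map_eq, AEMeasurable.map_map_of_aemeasurable (by fun_prop) h.aemeasurable]
    rfl
  rw [this, charFun_map_mul, charFun_cauchyMeasure]
  congr 2
  simp only [Real.coe_nnabs, abs_mul]
  push_cast; ring

/-- Linear combinations of elementary integrals have symmetric Cauchy laws, with the `L¹` norm of
the integrand as scale. -/
lemma charFun_combination [IsProbabilityMeasure P] (hL : IsCauchyMotion P L) {a b : ℝ}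
    (g h : StepFun a b) (u v x : ℝ) :
    charFun (P.map (fun ω => u * g.integral L ω + v * h.integral L ω)) x =
      Complex.exp (-(|x| * ∫ y in Set.Ioc a b, |u * g.toFun y + v * h.toFun y| : ℝ)) := by
  obtain ⟨N, t, ht, h0, hN, hg, hh⟩ := g.exists_common_grid h
  set d : ℕ → ℝ := fun j => u * g.toFun (t (j + 1)) + v * h.toFun (t (j + 1)) with hd
  have e : (fun ω => u * g.integral L ω + v * h.integral L ω) =
      fun ω => ∑ j ∈ Finset.range N, d j * (L (t (j + 1)) ω - L (t j) ω) := by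
    funext ω
    rw [hg.integral_eq ht, hh.integral_eq ht, Finset.mul_sum, Finset.mul_sum,
      ← Finset.sum_add_distrib]
    exact Finset.sum_congr rfl fun j _ => by simp only [hd]; ring
  have hind : iIndepFun (fun j ω => d j * (L (t (j + 1)) ω - L (t j) ω)) P :=
    (hL.indep.nat ht).comp (fun j y => d j * y) (fun j => measurable_const_mul (d j))
  rw [e, iIndepFun.charFun_map_fun_finsetSum_eq_prod
    (fun j _ => (hL.law _ _).aemeasurable.const_mul _) (hind.restrict _), Finset.prod_apply]
  simp only [hL.charFun_increment]
  rw [← Complex.exp_sum, g.setIntegral_abs_combination h ht h0 hN hg hh u v,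
    Finset.mul_sum]
  congr 1
  push_cast
  rw [Finset.sum_neg_distrib]
  congr 1
  refine Finset.sum_congr rfl fun j _ => ?_
  rw [abs_of_nonneg (sub_nonneg.2 (ht (Nat.le_succ j)))]
  simp [hd]

end IsCauchyMotion

/-- Reverse triangle inequality; it lets the Cauchy scale pass to the limit along `L¹`
approximations. -/
lemma eLpNorm_abs_combination_sub_le {α : Type*} [MeasurableSpace α] {μ : Measure α}
    {f₁ f₂ g h : α → ℝ} (s₁ : AEStronglyMeasurable (fun x => f₁ x - g x) μ)
    (s₂ : AEStronglyMeasurable (fun x => f₂ x - h x) μ) (u v : ℝ) :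
    eLpNorm ((fun y => |u * g y + v * h y|) - fun y => |u * f₁ y + v * f₂ y|) 1 μ ≤
      ENNReal.ofReal |u| * eLpNorm (fun x => f₁ x - g x) 1 μ +
        ENNReal.ofReal |v| * eLpNorm (fun x => f₂ x - h x) 1 μ := by
  have e₁ : ENNReal.ofReal |u| = ‖u‖ₑ := by rw [← Real.norm_eq_abs, ofReal_norm]
  have e₂ : ENNReal.ofReal |v| = ‖v‖ₑ := by rw [← Real.norm_eq_abs, ofReal_norm]
  have c₁ : eLpNorm (fun x => u * (f₁ x - g x)) 1 μ = _ :=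
    eLpNorm_const_smul u (fun x => f₁ x - g x) 1 μ
  have c₂ : eLpNorm (fun x => v * (f₂ x - h x)) 1 μ = _ :=
    eLpNorm_const_smul v (fun x => f₂ x - h x) 1 μ
  rw [e₁, e₂, ← c₁, ← c₂]
  calc _ ≤ eLpNorm ((fun x => u * (f₁ x - g x)) + fun x => v * (f₂ x - h x)) 1 μ := by
        refine eLpNorm_mono fun x => ?_
        simp only [Pi.sub_apply, Pi.add_apply, Real.norm_eq_abs]
        refine (abs_abs_sub_abs_le_abs_sub _ _).trans (le_of_eq ?_)
        rw [abs_sub_comm]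
        congr 1; ring
    _ ≤ _ := eLpNorm_add_le (s₁.const_mul u) (s₂.const_mul v) le_rfl

namespace IsCauchyMotion

variable {Ω : Type*} [MeasurableSpace Ω] {P : Measure Ω} {L : ℝ → Ω → ℝ}

/-- The joint characteristic function of two stochastic integrals against Cauchy motion. -/
lemma integral_cexp_stochIntegral [IsProbabilityMeasure P] (hL : IsCauchyMotion P L) {a b : ℝ}
    {f₁ f₂ : ℝ → ℝ} (hf₁ : IntegrableOn f₁ (Set.Ioc a b)) (hf₂ : IntegrableOn f₂ (Set.Ioc a b))
    {X₁ X₂ : Ω → ℝ} (h₁ : IsStochIntegral P L a b f₁ X₁) (h₂ : IsStochIntegral P L a b f₂ X₂)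
    (u v : ℝ) :
    ∫ ω, Complex.exp ((u * X₁ ω + v * X₂ ω : ℝ) * Complex.I) ∂P =
      Complex.exp (-(∫ y in Set.Ioc a b, |u * f₁ y + v * f₂ y| : ℝ)) := by
  obtain ⟨-, g, hg, hgX⟩ := h₁
  obtain ⟨-, h, hh, hhX⟩ := h₂
  -- The second subsequence is extracted from the first, so that both elementary integrals converge
  -- almost surely along `n₁ ∘ n₂`.
  obtain ⟨n₁, hn₁, hX₁⟩ := hgX.exists_seq_tendsto_ae
  obtain ⟨n₂, hn₂, hX₂⟩ := (hhX.comp hn₁.tendsto_atTop).exists_seq_tendsto_ae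
  have hn : Tendsto (n₁ ∘ n₂) atTop atTop := hn₁.tendsto_atTop.comp hn₂.tendsto_atTop
  have lim₁ : Tendsto (fun k => ∫ ω, Complex.exp
      ((u * (g (n₁ (n₂ k))).integral L ω + v * (h (n₁ (n₂ k))).integral L ω : ℝ) * Complex.I) ∂P)
      atTop (𝓝 (∫ ω, Complex.exp ((u * X₁ ω + v * X₂ ω : ℝ) * Complex.I) ∂P)) := by
    refine tendsto_integral_of_dominated_convergence (fun _ => 1) (fun k => ?_)
      (integrable_const _) (fun k => ae_of_all _ fun ω => ?_) ?_
    · have m₁ := hL.aemeasurable_integral (g (n₁ (n₂ k)))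
      have m₂ := hL.aemeasurable_integral (h (n₁ (n₂ k)))
      exact AEMeasurable.aestronglyMeasurable (by fun_prop)
    · rw [Complex.norm_exp_ofReal_mul_I]
    · filter_upwards [hX₁, hX₂] with ω e₁ e₂
      have e₁' := e₁.comp hn₂.tendsto_atTop
      have := ((e₁'.const_mul u).add (e₂.const_mul v))
      exact ((Complex.continuous_exp.comp
        (Complex.continuous_ofReal.mul continuous_const)).tendsto _).comp this
  have lim₂ : Tendsto (fun k => ∫ y in Set.Ioc a b, |u * (g k).toFun y + v * (h k).toFun y|)
      atTop (𝓝 (∫ y in Set.Ioc a b, |u * f₁ y + v * f₂ y|)) := by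
    refine tendsto_integral_of_L1' _ ((hf₁.const_mul u).add (hf₂.const_mul v)).abs.aestronglyMeasurable
      (Eventually.of_forall fun k => (((g k).integrable_toFun.const_mul u).add
        ((h k).integrable_toFun.const_mul v)).abs.integrableOn) ?_
    have up : Tendsto (fun k =>
        ENNReal.ofReal |u| * eLpNorm (fun x => f₁ x - (g k).toFun x) 1
          (volume.restrict (Set.Ioc a b)) +
        ENNReal.ofReal |v| * eLpNorm (fun x => f₂ x - (h k).toFun x) 1
          (volume.restrict (Set.Ioc a b))) atTop (𝓝 0) := by
      simpa using (ENNReal.Tendsto.const_mul hg (Or.inr ENNReal.ofReal_ne_top)).add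
        (ENNReal.Tendsto.const_mul hh (Or.inr ENNReal.ofReal_ne_top))
    refine tendsto_of_tendsto_of_tendsto_of_le_of_le tendsto_const_nhds up (fun _ => zero_le)
      fun k => ?_
    exact eLpNorm_abs_combination_sub_le
      (hf₁.sub ((g k).integrable_toFun.integrableOn (s := Set.Ioc a b))).aestronglyMeasurable
      (hf₂.sub ((h k).integrable_toFun.integrableOn (s := Set.Ioc a b))).aestronglyMeasurable u v
  have lim₃ := ((Complex.continuous_exp.comp Complex.continuous_ofReal.neg).tendsto _).comp
    (lim₂.comp hn)
  refine tendsto_nhds_unique lim₁ (lim₃.congr fun k => ?_)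
  have c := hL.charFun_combination (g (n₁ (n₂ k))) (h (n₁ (n₂ k))) u v 1
  have m₁ := hL.aemeasurable_integral (g (n₁ (n₂ k)))
  have m₂ := hL.aemeasurable_integral (h (n₁ (n₂ k)))
  rw [charFun_apply_real, integral_map (by fun_prop) (by fun_prop)] at c
  simpa using c.symm

/-- Tail bound for the difference of two elementary integrals. -/
lemma measure_lt_abs_integral_sub_le [IsProbabilityMeasure P] (hL : IsCauchyMotion P L) {a b : ℝ}
    (g h : StepFun a b) {r : ℝ} (hr : 0 < r) :
    P {ω | r < |g.integral L ω - h.integral L ω|} ≤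
      ENNReal.ofReal (4 * (∫ y in Set.Ioc a b, |g.toFun y - h.toFun y|) / r) := by
  set I : ℝ := ∫ y in Set.Ioc a b, |g.toFun y - h.toFun y| with hI
  have hI0 : 0 ≤ I := integral_nonneg fun _ => abs_nonneg _
  set Y : Ω → ℝ := fun ω => 1 * g.integral L ω + (-1) * h.integral L ω with hY
  have m₁ := hL.aemeasurable_integral g
  have m₂ := hL.aemeasurable_integral h
  have mY : AEMeasurable Y P := by fun_prop
  have : IsProbabilityMeasure (P.map Y) := Measure.isProbabilityMeasure_map mY
  have key := measureReal_abs_gt_le_integral_charFun (μ := P.map Y) hr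
  -- Here `1 - exp (-|t| I) ≤ |t| I ≤ 2 I / r`. The interval has length `4 / r` and `key` carries
  -- the factor `r / 2`, whence `4 I / r`.
  have bd : ∀ t ∈ Set.uIoc (-2 * r⁻¹) (2 * r⁻¹), ‖1 - charFun (P.map Y) t‖ ≤ 2 * r⁻¹ * I := by
    intro t ht
    have ht' : |t| ≤ 2 * r⁻¹ := by
      rw [Set.uIoc_of_le (by have := inv_pos.2 hr; linarith)] at ht
      exact abs_le.2 ⟨by linarith [ht.1], ht.2⟩
    have c := hL.charFun_combination g h 1 (-1) t
    simp only [one_mul, neg_mul, ← sub_eq_add_neg] at c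
    simp only [hY, one_mul, neg_mul, ← sub_eq_add_neg]
    rw [c, ← hI, ← Complex.ofReal_neg, ← Complex.ofReal_exp, ← Complex.ofReal_one,
      ← Complex.ofReal_sub, Complex.norm_real, Real.norm_eq_abs]
    have h1 := Real.add_one_le_exp (-(|t| * I))
    have h2 : Real.exp (-(|t| * I)) ≤ 1 := Real.exp_le_one_iff.2 (by
      have := mul_nonneg (abs_nonneg t) hI0; linarith)
    rw [abs_of_nonneg (by linarith)]
    have := mul_le_mul_of_nonneg_right ht' hI0
    linarith
  have nb := intervalIntegral.norm_integral_le_of_norm_le_const bd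
  have hset : P.map Y {x | r < |x|} = P {ω | r < |g.integral L ω - h.integral L ω|} := by
    rw [Measure.map_apply_of_aemeasurable mY (measurableSet_lt measurable_const (by fun_prop))]
    simp [hY, ← sub_eq_add_neg]
  rw [← hset, ← ofReal_measureReal]
  refine ENNReal.ofReal_le_ofReal (key.trans ?_)
  calc 2⁻¹ * r * ‖∫ t in (-2 * r⁻¹)..(2 * r⁻¹), 1 - charFun (P.map Y) t‖
      ≤ 2⁻¹ * r * (2 * r⁻¹ * I * |2 * r⁻¹ - -2 * r⁻¹|) := by gcongr
    _ = 4 * I / r := by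
      rw [show 2 * r⁻¹ - -2 * r⁻¹ = 4 * r⁻¹ by ring, abs_of_pos (by positivity)]
      field_simp

/-- Rapid `L¹` approximation by step functions yields a stochastic integral. -/
lemma exists_isStochIntegral [IsProbabilityMeasure P] (hL : IsCauchyMotion P L) {a b : ℝ}
    {f : ℝ → ℝ} (hf : IntegrableOn f (Set.Ioc a b)) (g : ℕ → StepFun a b) (C : ℝ)
    (hg : ∀ k, ∫ y in Set.Ioc a b, |f y - (g k).toFun y| ≤ C * (1 / 4) ^ k) :
    ∃ X : Ω → ℝ, IsStochIntegral P L a b f X := by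
  have hi : ∀ k, IntegrableOn (fun y => f y - (g k).toFun y) (Set.Ioc a b) :=
    fun k => hf.sub (g k).integrable_toFun.integrableOn
  have hdiff : ∀ k, ∫ y in Set.Ioc a b, |(g k).toFun y - (g (k + 1)).toFun y| ≤
      2 * C * (1 / 4) ^ k := by
    intro k
    have hC : 0 ≤ C * (1 / 4) ^ k := (integral_nonneg fun _ => abs_nonneg _).trans (hg k)
    calc ∫ y in Set.Ioc a b, |(g k).toFun y - (g (k + 1)).toFun y|
        ≤ ∫ y in Set.Ioc a b, (|f y - (g k).toFun y| + |f y - (g (k + 1)).toFun y|) := by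
          refine integral_mono ((g k).integrable_toFun.sub
            (g (k + 1)).integrable_toFun).abs.integrableOn
            ((hi k).abs.add (hi (k + 1)).abs) fun y => ?_
          rw [abs_sub_comm (f y) ((g k).toFun y)]
          exact abs_sub_le _ _ _
      _ ≤ C * (1 / 4) ^ k + C * (1 / 4) ^ (k + 1) := by
          rw [integral_add (hi k).abs (hi (k + 1)).abs]
          exact add_le_add (hg k) (hg (k + 1))
      _ ≤ 2 * C * (1 / 4) ^ k := by rw [pow_succ]; linarith
  -- The rate `4⁻ᵏ` is split: a threshold `2⁻ᵏ` leaves a probability of order `2⁻ᵏ`. Both are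
  -- summable, as Borel–Cantelli and the Cauchy property require.
  have hP : ∀ k, P {ω | (1 / 2 : ℝ) ^ k < |(g k).integral L ω - (g (k + 1)).integral L ω|} ≤
      ENNReal.ofReal (8 * C * (1 / 2) ^ k) := by
    intro k
    refine (hL.measure_lt_abs_integral_sub_le _ _ (by positivity)).trans
      (ENNReal.ofReal_le_ofReal ?_)
    rw [div_le_iff₀ (by positivity)]
    have : (1 / 2 : ℝ) ^ k * (1 / 2) ^ k = (1 / 4) ^ k := by rw [← mul_pow]; norm_num
    calc _ ≤ 4 * (2 * C * (1 / 4) ^ k) := by linarith [hdiff k]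
      _ = _ := by rw [← this]; ring
  have hsum : Summable fun k : ℕ => 8 * C * (1 / 2 : ℝ) ^ k :=
    (summable_geometric_of_lt_one (by norm_num) (by norm_num)).mul_left _
  have hBC := measure_limsup_atTop_eq_zero (μ := P) (s := fun k =>
    {ω | (1 / 2 : ℝ) ^ k < |(g k).integral L ω - (g (k + 1)).integral L ω|})
    (ne_top_of_le_ne_top hsum.tsum_ofReal_ne_top (ENNReal.tsum_le_tsum hP))
  have hconv : ∀ᵐ ω ∂P, ∃ l, Tendsto (fun k => (g k).integral L ω) atTop (𝓝 l) := by
    have hae := measure_eq_zero_iff_ae_notMem.1 hBC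
    filter_upwards [hae] with ω hω
    rw [mem_limsup_iff_frequently_mem, not_frequently] at hω
    refine cauchySeq_tendsto_of_complete (cauchySeq_of_summable_dist ?_)
    refine Summable.of_norm_bounded_eventually_nat
      (summable_geometric_of_lt_one (r := (1 / 2 : ℝ)) (by norm_num) (by norm_num)) ?_
    filter_upwards [hω] with k hk
    rw [Real.dist_eq, Real.norm_eq_abs, abs_abs]
    exact not_lt.1 hk
  obtain ⟨X, hX, hlim⟩ := measurable_limit_of_tendsto_metrizable_ae
    (fun k => hL.aemeasurable_integral (g k)) hconv
  refine ⟨X, hX.aemeasurable, g, ?_, tendstoInMeasure_of_tendsto_ae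
    (fun k => (hL.aemeasurable_integral (g k)).aestronglyMeasurable) hlim⟩
  have hz : Tendsto (fun k : ℕ => ENNReal.ofReal (C * (1 / 4) ^ k)) atTop (𝓝 0) := by
    have := (tendsto_pow_atTop_nhds_zero_of_lt_one (r := (1 / 4 : ℝ)) (by norm_num)
      (by norm_num)).const_mul C
    simpa using ENNReal.tendsto_ofReal this
  refine tendsto_of_tendsto_of_tendsto_of_le_of_le tendsto_const_nhds hz (fun _ => zero_le)
    fun k => ?_
  simp only
  rw [eLpNorm_one_eq_lintegral_enorm, ← ofReal_integral_norm_eq_lintegral_enorm (hi k)]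
  exact ENNReal.ofReal_le_ofReal (hg k)

end IsCauchyMotion

/-! ### Step approximations of the two integrands -/

namespace StepFun

/-- The step function `1` on `(0, 1]`. -/
def unit : StepFun 0 1 where
  n := 1
  node i := if i = 0 then 0 else 1
  coef _ := 1
  mono i j hij := by
    by_cases hi : i = 0
    · by_cases hj : j = 0 <;> simp [hi, hj]
    · simp [hi, show j ≠ 0 by omega]
  mem i := by by_cases hi : i = 0 <;> simp [hi]

lemma unit_toFun {x : ℝ} (hx : x ∈ Set.Ioc (0 : ℝ) 1) : unit.toFun x = 1 := by
  simp only [toFun, unit, Finset.sum_range_one]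
  simp [hx.1, hx.2]

/-- The staircase with `n` steps below the identity on `(0, 1]`. -/
noncomputable def staircase (n : ℕ) : StepFun 0 1 where
  n := n
  node i := min (i / n) 1
  coef i := i / n
  mono i j hij := by
    refine min_le_min ?_ le_rfl
    gcongr
  mem i := ⟨le_min (by positivity) zero_le_one, min_le_right _ _⟩

lemma abs_sub_staircase_toFun_le {n : ℕ} (hn : 0 < n) {x : ℝ} (hx : x ∈ Set.Ioc (0 : ℝ) 1) :
    |x - (staircase n).toFun x| ≤ 1 / n := by
  have hn' : (0 : ℝ) < n := by exact_mod_cast hn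
  -- This `i` is the index of the piece `(i / n, (i + 1) / n]` containing `x`.
  obtain ⟨i, hi⟩ : ∃ i, ⌈n * x⌉₊ = i + 1 :=
    Nat.exists_eq_succ_of_ne_zero (Nat.ceil_pos.2 (mul_pos hn' hx.1)).ne'
  have hin : i < n := by
    have : ⌈n * x⌉₊ ≤ n := Nat.ceil_le.2 (by nlinarith [hx.2])
    omega
  have h1 : (i : ℝ) < n * x := Nat.lt_ceil.1 (by omega)
  have h2 : n * x ≤ i + 1 := by exact_mod_cast Nat.ceil_le.1 hi.le
  have key : (staircase n).toFun x = i / n := by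
    simp only [toFun, staircase]
    rw [Finset.sum_eq_single i]
    · rw [Set.indicator_of_mem]
      refine ⟨lt_of_le_of_lt (min_le_left _ _) ((div_lt_iff₀ hn').2 (by linarith)),
        le_min ((le_div_iff₀ hn').2 (by push_cast; linarith)) hx.2⟩
    · intro j _ hj
      rw [Set.indicator_of_notMem]
      rintro ⟨h3, h4⟩
      rcases lt_or_gt_of_ne hj with h | h
      · have h5 := (le_div_iff₀ hn').1 (h4.trans (min_le_left _ _))
        have h6 : ((j + 1 : ℕ) : ℝ) ≤ i := by exact_mod_cast h
        linarith
      · rcases min_lt_iff.1 h3 with h7 | h7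
        · have h5 := (div_lt_iff₀ hn').1 h7
          have h6 : ((i + 1 : ℕ) : ℝ) ≤ j := by exact_mod_cast h
          push_cast at h6
          linarith
        · linarith [hx.2]
    · intro h; exact absurd (Finset.mem_range.2 hin) h
  rw [key, show x - i / n = (n * x - i) / n by field_simp, abs_of_nonneg
    (div_nonneg (by linarith) hn'.le)]
  gcongr
  linarith

end StepFun

lemma IsCauchyMotion.exists_isStochIntegral_one {Ω : Type*} [MeasurableSpace Ω] {P : Measure Ω}
    [IsProbabilityMeasure P] {L : ℝ → Ω → ℝ} (hL : IsCauchyMotion P L) :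
    ∃ X : Ω → ℝ, IsStochIntegral P L 0 1 (fun _ => 1) X := by
  refine hL.exists_isStochIntegral (integrableOn_const (by simp)) (fun _ => StepFun.unit) 0
    fun k => ?_
  rw [setIntegral_congr_fun (g := fun _ => 0) measurableSet_Ioc
    (fun x hx => by simp [StepFun.unit_toFun hx])]
  simp

lemma IsCauchyMotion.exists_isStochIntegral_id {Ω : Type*} [MeasurableSpace Ω] {P : Measure Ω}
    [IsProbabilityMeasure P] {L : ℝ → Ω → ℝ} (hL : IsCauchyMotion P L) :
    ∃ X : Ω → ℝ, IsStochIntegral P L 0 1 (fun z => z) X := by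
  have hid : IntegrableOn (fun z : ℝ => z) (Set.Ioc 0 1) :=
    (continuous_id.integrableOn_Icc).mono_set Set.Ioc_subset_Icc_self
  refine hL.exists_isStochIntegral hid (fun k => StepFun.staircase (4 ^ k)) 1 fun k => ?_
  calc ∫ y in Set.Ioc (0 : ℝ) 1, |y - (StepFun.staircase (4 ^ k)).toFun y|
      ≤ ∫ y in Set.Ioc (0 : ℝ) 1, (1 / (4 ^ k : ℕ) : ℝ) := by
        refine setIntegral_mono_on (hid.sub (StepFun.integrable_toFun _).integrableOn).abs
          (integrableOn_const (by simp)) measurableSet_Ioc fun x hx =>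
          StepFun.abs_sub_staircase_toFun_le (by positivity) hx
    _ = 1 * (1 / 4) ^ k := by simp

/-! ### Fourier inversion for finite measures -/

section Inversion

open scoped FourierTransform ComplexOrder RealInnerProductSpace

variable {V : Type*} [NormedAddCommGroup V] [InnerProductSpace ℝ V] [MeasurableSpace V]
  [BorelSpace V] [FiniteDimensional ℝ V]

/-- The density of a finite measure with integrable characteristic function, written as a Fourier
integral. -/
noncomputable def charDensity (μ : Measure V) : V → ℂ :=
  𝓕 (fun w : V => charFun μ ((2 * Real.pi) • w))

lemma charFun_two_pi_smul {E : Type*} [NormedAddCommGroup E] [InnerProductSpace ℝ E]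
    [MeasurableSpace E] {μ : Measure E} (w : E) :
    charFun μ ((2 * Real.pi) • w) = ∫ y, Complex.exp (2 * Real.pi * ⟪y, w⟫ * Complex.I) ∂μ := by
  rw [charFun_apply]
  simp [inner_smul_right]

variable {μ : Measure V}

lemma integrable_charFun_two_pi_smul (hμ : Integrable (charFun μ)) :
    Integrable (fun w : V => charFun μ ((2 * Real.pi) • w)) :=
  hμ.comp_smul (by positivity)

lemma continuous_charDensity (hμ : Integrable (charFun μ)) : Continuous (charDensity μ) :=
  VectorFourier.fourierIntegral_continuous Real.continuous_fourierChar continuous_inner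
    (integrable_charFun_two_pi_smul hμ)

/-- Moving the Fourier transform onto the Gaussian turns the latter into a probability density,
against which the characteristic function is at most the total mass. The bound does not depend on
`b`. -/
lemma norm_integral_gaussian_mul_charDensity_le (hμ : Integrable (charFun μ)) {b : ℝ}
    (hb : 0 < b) :
    ‖∫ x : V, Complex.exp (-b * ‖x‖ ^ 2) * charDensity μ x‖ ≤ μ.real Set.univ := by
  have hb' : 0 < (b : ℂ).re := by simpa
  have hπ := Real.pi_pos
  have h1 : Integrable (fun w : V => Complex.exp (-b * ‖w‖ ^ 2)) := by
    simpa using GaussianFourier.integrable_cexp_neg_mul_sq_norm_add hb' 0 (0 : V)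
  have flip := VectorFourier.integral_fourierIntegral_smul_eq_flip (L := innerₗ V)
    Real.continuous_fourierChar continuous_inner h1 (integrable_charFun_two_pi_smul hμ)
  have flip' : ∫ x : V, Complex.exp (-b * ‖x‖ ^ 2) * charDensity μ x =
      ∫ w : V, 𝓕 (fun w : V => Complex.exp (-b * ‖w‖ ^ 2)) w *
        charFun μ ((2 * Real.pi) • w) := by
    simpa using! flip.symm
  have e : ∫ w : V, (Real.pi / b) ^ (Module.finrank ℝ V / 2 : ℝ) *
      Real.exp (-(Real.pi ^ 2 / b) * ‖w‖ ^ 2) = 1 := by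
    rw [integral_const_mul, GaussianFourier.integral_rexp_neg_mul_sq_norm (by positivity),
      ← Real.mul_rpow (by positivity) (by positivity),
      show Real.pi / b * (Real.pi / (Real.pi ^ 2 / b)) = 1 by field_simp, Real.one_rpow]
  rw [flip']
  calc ‖∫ w : V, 𝓕 (fun w : V => Complex.exp (-b * ‖w‖ ^ 2)) w * charFun μ ((2 * Real.pi) • w)‖
      ≤ ∫ w : V, ((Real.pi / b) ^ (Module.finrank ℝ V / 2 : ℝ) *
      Real.exp (-(Real.pi ^ 2 / b) * ‖w‖ ^ 2)) * μ.real Set.univ := by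
        refine norm_integral_le_of_norm_le
          ((Integrable.of_integral_ne_zero (by rw [e]; exact one_ne_zero)).mul_const _)
          (ae_of_all _ fun w => ?_)
        rw [norm_mul, fourier_gaussian_innerProductSpace hb', norm_mul]
        gcongr
        · refine le_of_eq ?_
          have : ((Real.pi / b : ℂ) ^ (Module.finrank ℝ V / 2 : ℂ)) =
              (((Real.pi / b) ^ (Module.finrank ℝ V / 2 : ℝ) : ℝ) : ℂ) := by
            rw [Complex.ofReal_cpow (by positivity)]; push_cast; rfl
          rw [this, Complex.norm_real, Real.norm_eq_abs, abs_of_nonneg (by positivity)]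
        · refine le_of_eq ?_
          rw [show (-Real.pi ^ 2 * ‖w‖ ^ 2 / b : ℂ) =
            ((-(Real.pi ^ 2 / b) * ‖w‖ ^ 2 : ℝ) : ℂ) by push_cast; ring, ← Complex.ofReal_exp,
            Complex.norm_real, Real.norm_eq_abs, abs_of_nonneg (Real.exp_pos _).le]
        · exact norm_charFun_le _
    _ = μ.real Set.univ := by rw [integral_mul_const, e, one_mul]

variable [IsFiniteMeasure μ]

lemma continuous_charFun_two_pi_smul :
    Continuous (fun w : V => charFun μ ((2 * Real.pi) • w)) := by
  have : Continuous (charFun μ) := continuous_charFun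
  fun_prop

/-- The Gaussian factor permits Fubini, and the inner integral over `w` is then a positive Gaussian
in `y - x`. -/
lemma gaussian_charDensity_nonneg {b : ℝ} (hb : 0 < b) (x : V) :
    0 ≤ ∫ w : V, Complex.exp (-b * ‖w‖ ^ 2) *
      (Complex.exp (-2 * Real.pi * ⟪w, x⟫ * Complex.I) * charFun μ ((2 * Real.pi) • w)) := by
  have hb' : 0 < (b : ℂ).re := by simpa
  have hint : Integrable (fun p : V × V => Complex.exp (-b * ‖p.1‖ ^ 2) *
      Complex.exp ((2 * Real.pi * ⟪p.2 - x, p.1⟫ : ℝ) * Complex.I)) (volume.prod μ) := by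
    have h1 : Integrable (fun w : V => Complex.exp (-b * ‖w‖ ^ 2)) := by
      simpa using GaussianFourier.integrable_cexp_neg_mul_sq_norm_add hb' 0 (0 : V)
    have h2 := h1.mul_prod (integrable_const (1 : ℂ) (μ := μ))
    refine h2.mono (Continuous.aestronglyMeasurable (by fun_prop)) (ae_of_all _ fun p => ?_)
    rw [norm_mul, norm_mul, Complex.norm_exp_ofReal_mul_I, norm_one]
  have e1 : ∀ w : V, Complex.exp (-b * ‖w‖ ^ 2) *
      (Complex.exp (-2 * Real.pi * ⟪w, x⟫ * Complex.I) * charFun μ ((2 * Real.pi) • w)) =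
      ∫ y, Complex.exp (-b * ‖w‖ ^ 2) *
        Complex.exp ((2 * Real.pi * ⟪y - x, w⟫ : ℝ) * Complex.I) ∂μ := by
    intro w
    rw [charFun_two_pi_smul, ← integral_const_mul, ← integral_const_mul]
    refine integral_congr_ae (ae_of_all _ fun y => ?_)
    simp only [← Complex.exp_add]
    congr 2
    rw [inner_sub_left, real_inner_comm x w]
    push_cast; ring
  simp_rw [e1]
  rw [integral_integral_swap hint]
  refine integral_nonneg fun y => ?_
  have e2 : ∫ w : V, Complex.exp (-b * ‖w‖ ^ 2) *
      Complex.exp ((2 * Real.pi * ⟪y - x, w⟫ : ℝ) * Complex.I) =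
      ((Real.pi / b) ^ (Module.finrank ℝ V / 2 : ℝ) *
        Real.exp (-(Real.pi ^ 2 * ‖y - x‖ ^ 2 / b)) : ℝ) := by
    have := GaussianFourier.integral_cexp_neg_mul_sq_norm_add hb' (2 * Real.pi * Complex.I) (y - x)
    simp_rw [← Complex.exp_add]
    rw [Complex.ofReal_mul, Complex.ofReal_cpow (by positivity), Complex.ofReal_exp]
    have e3 : (2 * Real.pi * Complex.I) ^ 2 * (‖y - x‖ : ℂ) ^ 2 / (4 * b) =
        ((-(Real.pi ^ 2 * ‖y - x‖ ^ 2 / b) : ℝ) : ℂ) := by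
      have : (b : ℂ) ≠ 0 := by exact_mod_cast hb.ne'
      push_cast
      rw [mul_pow, Complex.I_sq]
      field_simp
      ring
    rw [e3] at this
    convert this using 3
    · push_cast; ring_nf
    · push_cast; ring_nf
    · push_cast; rfl
  change 0 ≤ ∫ w : V, _
  rw [e2]
  exact Complex.zero_le_real.2 (by positivity)

/-- Limit of the nonnegative regularized integrals as the Gaussian parameter `b = c⁻¹` tends to `0`.
-/
lemma charDensity_nonneg (hμ : Integrable (charFun μ)) (x : V) : 0 ≤ charDensity μ x := by
  have hi : Integrable (fun w : V => Complex.exp (-2 * Real.pi * ⟪w, x⟫ * Complex.I) *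
      charFun μ ((2 * Real.pi) • w)) := by
    refine (integrable_charFun_two_pi_smul hμ).bdd_mul (c := 1)
      (Continuous.aestronglyMeasurable (by fun_prop)) (ae_of_all _ fun w => ?_)
    rw [show (-2 * Real.pi * ⟪w, x⟫ * Complex.I : ℂ) =
      ((-2 * Real.pi * ⟪w, x⟫ : ℝ) : ℂ) * Complex.I by push_cast; ring,
      Complex.norm_exp_ofReal_mul_I]
  have lim := Real.tendsto_integral_cexp_sq_smul hi
  have e : charDensity μ x = ∫ w : V, Complex.exp (-2 * Real.pi * ⟪w, x⟫ * Complex.I) *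
      charFun μ ((2 * Real.pi) • w) := by
    rw [charDensity, Real.fourier_eq']
    simp [smul_eq_mul]
  rw [e]
  refine ge_of_tendsto lim ?_
  filter_upwards [eventually_gt_atTop 0] with c hc
  have := gaussian_charDensity_nonneg (μ := μ) (inv_pos.2 hc) x
  simpa [smul_eq_mul] using this

lemma ofReal_re_charDensity (hμ : Integrable (charFun μ)) (x : V) :
    ((charDensity μ x).re : ℂ) = charDensity μ x :=
  (Complex.eq_re_of_ofReal_le (r := 0) (by simpa using charDensity_nonneg hμ x)).symm

lemma re_charDensity_nonneg (hμ : Integrable (charFun μ)) (x : V) : 0 ≤ (charDensity μ x).re :=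
  (Complex.le_def.1 (charDensity_nonneg hμ x)).1

/-- By nonnegativity the norm of the Gaussian-weighted integral is the integral of the norm, so the
uniform bound controls the latter. Fatou's lemma with `b = 1 / (n + 1)` removes the weight. -/
lemma integrable_charDensity (hμ : Integrable (charFun μ)) : Integrable (charDensity μ) := by
  have hc := continuous_charDensity hμ
  obtain ⟨M, hM⟩ : ∃ M, ∀ x, ‖charDensity μ x‖ ≤ M :=
    ⟨_, fun x => VectorFourier.norm_fourierIntegral_le_integral_norm _ _ _ _ _⟩
  refine ⟨hc.aestronglyMeasurable, ?_⟩
  have hbd : ∀ b : ℝ, 0 < b → ∫⁻ x : V, ‖Complex.exp (-b * ‖x‖ ^ 2) * charDensity μ x‖ₑ ≤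
      ENNReal.ofReal (μ.real Set.univ) := by
    intro b hb
    have h1 : Integrable (fun w : V => Complex.exp (-b * ‖w‖ ^ 2)) := by
      simpa using GaussianFourier.integrable_cexp_neg_mul_sq_norm_add
        (b := b) (by simpa) 0 (0 : V)
    have hi : Integrable (fun x : V => Complex.exp (-b * ‖x‖ ^ 2) * charDensity μ x) :=
      h1.mul_bdd hc.aestronglyMeasurable (ae_of_all _ hM)
    rw [← ofReal_integral_norm_eq_lintegral_enorm hi]
    refine ENNReal.ofReal_le_ofReal (le_trans ?_
      (norm_integral_gaussian_mul_charDensity_le hμ hb))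
    have : ∫ x : V, Complex.exp (-b * ‖x‖ ^ 2) * charDensity μ x =
        ((∫ x : V, ‖Complex.exp (-b * ‖x‖ ^ 2) * charDensity μ x‖ : ℝ) : ℂ) := by
      rw [← integral_complex_ofReal]
      refine integral_congr_ae (ae_of_all _ fun x => ?_)
      simp only
      rw [norm_mul, ← ofReal_re_charDensity hμ x, Complex.norm_real, Real.norm_eq_abs,
        abs_of_nonneg (re_charDensity_nonneg hμ x), Complex.ofReal_mul,
        show (-b * ‖x‖ ^ 2 : ℂ) = ((-b * ‖x‖ ^ 2 : ℝ) : ℂ) by push_cast; ring,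
        ← Complex.ofReal_exp, Complex.norm_real, Real.norm_eq_abs,
        abs_of_nonneg (Real.exp_pos _).le]
    rw [this, Complex.norm_real]
    exact le_abs_self _
  have lim : ∀ x : V, Tendsto (fun n : ℕ =>
      ‖Complex.exp (-(1 / ((n : ℝ) + 1) : ℝ) * ‖x‖ ^ 2) * charDensity μ x‖ₑ) atTop
      (𝓝 ‖charDensity μ x‖ₑ) := by
    intro x
    have h0 := (tendsto_one_div_add_atTop_nhds_zero_nat (𝕜 := ℝ))
    have hcont : Continuous (fun r : ℝ => ‖Complex.exp (-r * ‖x‖ ^ 2) * charDensity μ x‖ₑ) := by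
      fun_prop
    have := (hcont.tendsto 0).comp h0
    simpa [Function.comp_def] using this
  refine lt_of_le_of_lt ?_ (ENNReal.ofReal_lt_top (r := μ.real Set.univ))
  calc ∫⁻ x : V, ‖charDensity μ x‖ₑ
      = ∫⁻ x : V, liminf (fun n : ℕ =>
        ‖Complex.exp (-(1 / ((n : ℝ) + 1) : ℝ) * ‖x‖ ^ 2) * charDensity μ x‖ₑ) atTop :=
        lintegral_congr fun x => (lim x).liminf_eq.symm
    _ ≤ liminf (fun n : ℕ => ∫⁻ x : V,
        ‖Complex.exp (-(1 / ((n : ℝ) + 1) : ℝ) * ‖x‖ ^ 2) * charDensity μ x‖ₑ) atTop :=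
        lintegral_liminf_le fun n => by
          have := hc.measurable
          fun_prop
    _ ≤ ENNReal.ofReal (μ.real Set.univ) :=
        liminf_le_of_le (by isBoundedDefault) fun _ h => by
          obtain ⟨n, hn⟩ := h.exists
          exact hn.trans (hbd _ (by positivity))

/-- **Inversion formula**: a finite measure with integrable characteristic function has the
density `charDensity`. -/
theorem eq_withDensity_charDensity (hμ : Integrable (charFun μ)) :
    μ = volume.withDensity (fun x => ENNReal.ofReal (charDensity μ x).re) := by
  have hi := integrable_charDensity hμ
  have hc := continuous_charDensity hμ
  have hm : Measurable (fun x => ENNReal.ofReal (charDensity μ x).re) := by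
    have := hc.measurable
    fun_prop
  have : IsFiniteMeasure (volume.withDensity
      (fun x => ENNReal.ofReal (charDensity μ x).re)) :=
    isFiniteMeasure_withDensity_ofReal hi.re.2
  refine Measure.ext_of_charFun (funext fun t => ?_)
  have inv := congrFun (continuous_charFun_two_pi_smul.fourierInv_fourier_eq
    (integrable_charFun_two_pi_smul hμ) hi) ((2 * Real.pi)⁻¹ • t)
  rw [smul_inv_smul₀ (by positivity)] at inv
  rw [← inv, charFun_apply, Real.fourierInv_eq',
    integral_withDensity_eq_integral_toReal_smul hm (ae_of_all _ fun x => ENNReal.ofReal_lt_top)]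
  refine integral_congr_ae (ae_of_all _ fun x => ?_)
  beta_reduce
  rw [ENNReal.toReal_ofReal (re_charDensity_nonneg hμ x), inner_smul_right,
    mul_inv_cancel_left₀ (by positivity), Complex.real_smul, ofReal_re_charDensity hμ, smul_eq_mul,
    mul_comm]
  rfl

end Inversion

/-! ### The norm in the exponent -/

/-- The `L¹(0, 1)` norm of `y ↦ u + v y`. -/
noncomputable def affineNorm (u v : ℝ) : ℝ := ∫ y in (0 : ℝ)..1, |u + v * y|

lemma continuous_affineNorm : Continuous (fun p : ℝ × ℝ => affineNorm p.1 p.2) :=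
  intervalIntegral.continuous_parametric_intervalIntegral_of_continuous' (by fun_prop) 0 1

lemma affineNorm_mul (c u v : ℝ) : affineNorm (c * u) (c * v) = |c| * affineNorm u v := by
  simp only [affineNorm, ← intervalIntegral.integral_const_mul, ← abs_mul]
  congr 1; funext y; congr 1; ring

/-- Testing `u + v y` against `1` and `1 - 2 y`, both bounded by `1`, shows that the norm `N` is at
least `|u + v / 2|` and `|v| / 6`. Hence `|v| ≤ 6 N` and `|u| ≤ N + 3 N`. -/
lemma abs_add_abs_le_affineNorm (u v : ℝ) : |u| + |v| ≤ 10 * affineNorm u v := by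
  have hi : IntervalIntegrable (fun y => |u + v * y|) volume 0 1 :=
    Continuous.intervalIntegrable (by fun_prop) _ _
  have h1 : |u + v / 2| ≤ affineNorm u v := by
    have e : ∫ y in (0 : ℝ)..1, (u + v * y) = u + v / 2 := by
      rw [intervalIntegral.integral_add (by simp)
        (Continuous.intervalIntegrable (by fun_prop) _ _), intervalIntegral.integral_const_mul]
      simp; ring
    rw [← e]
    exact intervalIntegral.abs_integral_le_integral_abs zero_le_one
  have h2 : |v| / 6 ≤ affineNorm u v := by
    have e : ∫ y in (0 : ℝ)..1, (u + v * y) * (1 - 2 * y) = -v / 6 := by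
      have : ∀ y : ℝ, HasDerivAt
          (fun y => u * y - u * y ^ 2 + v * y ^ 2 / 2 - 2 * v * y ^ 3 / 3)
          ((u + v * y) * (1 - 2 * y)) y := by
        intro y
        have d := ((((hasDerivAt_id' y).const_mul u).sub ((hasDerivAt_pow 2 y).const_mul u)).add
          (((hasDerivAt_pow 2 y).const_mul v).div_const 2)).sub
          (((hasDerivAt_pow 3 y).const_mul (2 * v)).div_const 3)
        refine d.congr_deriv ?_
        push_cast; ring
      rw [intervalIntegral.integral_eq_sub_of_hasDerivAt (fun y _ => this y)
        (Continuous.intervalIntegrable (by fun_prop) _ _)]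
      ring
    have e' : |v| / 6 = |∫ y in (0 : ℝ)..1, (u + v * y) * (1 - 2 * y)| := by
      rw [e, abs_div, abs_neg]; norm_num
    rw [e']
    refine (intervalIntegral.abs_integral_le_integral_abs zero_le_one).trans
      (intervalIntegral.integral_mono_on zero_le_one
        (Continuous.intervalIntegrable (by fun_prop) _ _) hi fun y hy => ?_)
    rw [abs_mul]
    have : |1 - 2 * y| ≤ 1 := abs_le.2 ⟨by linarith [hy.2], by linarith [hy.1]⟩
    exact mul_le_of_le_one_right (abs_nonneg _) this
  have h3 : |u| ≤ |u + v / 2| + |v| / 2 := by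
    have := abs_sub (u + v / 2) (v / 2)
    rw [abs_div, abs_two, add_sub_cancel_right] at this
    exact this
  linarith

lemma affineNorm_one_of_neg_one_le {w : ℝ} (hw : -1 ≤ w) : affineNorm 1 w = 1 + w / 2 := by
  have e : ∀ y ∈ Set.uIcc (0 : ℝ) 1, |1 + w * y| = 1 + w * y := by
    intro y hy
    rw [Set.uIcc_of_le zero_le_one] at hy
    exact abs_of_nonneg (by nlinarith [hy.1, hy.2])
  rw [affineNorm, intervalIntegral.integral_congr e, intervalIntegral.integral_add (by simp)
    (Continuous.intervalIntegrable (by fun_prop) _ _), intervalIntegral.integral_const_mul]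
  simp; ring

/-- The integrand changes sign at `c = -1 / w` in `(0, 1)`. In this form the factor `c² - c + 1 / 2`
is the real part of `cauchyQuad` at `c`. -/
lemma affineNorm_one_of_lt_neg_one {w : ℝ} (hw : w < -1) :
    affineNorm 1 w = -w * ((-1 / w) ^ 2 - (-1 / w) + 1 / 2) := by
  have hw0 : w ≠ 0 := by linarith
  set c : ℝ := -1 / w with hc
  have hc0 : 0 ≤ c := div_nonneg_of_nonpos (by norm_num) (by linarith)
  have hc1 : c ≤ 1 := by
    rw [hc, div_le_one_of_neg (by linarith)]; exact hw.le
  have hwc : w * c = -1 := by rw [hc]; field_simp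
  have anti : ∀ a b : ℝ, ∫ y in a..b, (1 + w * y) = (b - a) + w * (b ^ 2 - a ^ 2) / 2 := by
    intro a b
    rw [intervalIntegral.integral_add (by simp)
      (Continuous.intervalIntegrable (by fun_prop) _ _), intervalIntegral.integral_const_mul]
    simp; ring
  have e1 : ∫ y in (0 : ℝ)..c, |1 + w * y| = ∫ y in (0 : ℝ)..c, (1 + w * y) := by
    refine intervalIntegral.integral_congr fun y hy => ?_
    rw [Set.uIcc_of_le hc0] at hy
    exact abs_of_nonneg (by nlinarith [hy.1, hy.2])
  have e2 : ∫ y in c..1, |1 + w * y| = ∫ y in c..1, -(1 + w * y) := by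
    refine intervalIntegral.integral_congr fun y hy => ?_
    rw [Set.uIcc_of_le hc1] at hy
    exact abs_of_nonpos (by nlinarith [hy.1, hy.2])
  have hw' : w = -1 / c := by
    have : c ≠ 0 := by intro h; rw [h] at hwc; simp at hwc
    field_simp; linarith
  have hcne : c ≠ 0 := by intro h; rw [h] at hwc; simp at hwc
  rw [affineNorm, ← intervalIntegral.integral_add_adjacent_intervals (b := c)
    (Continuous.intervalIntegrable (by fun_prop) _ _)
    (Continuous.intervalIntegrable (by fun_prop) _ _), e1, e2, intervalIntegral.integral_neg,
    anti, anti]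
  clear_value c
  subst hw'
  field_simp
  ring

lemma affineNorm_one_pos (w : ℝ) : 0 < affineNorm 1 w := by
  have := abs_add_abs_le_affineNorm 1 w
  rw [abs_one] at this
  linarith [abs_nonneg w]

/-! ### Reduction of the Fourier integral to one variable -/

section Laplace

variable {a : ℂ}

/-- Half of the exponential decay absorbs the factor `x`. -/
lemma norm_mul_cexp_le (ha : 0 < a.re) {x : ℝ} (hx : 0 ≤ x) :
    ‖(x : ℂ) * Complex.exp (-a * x)‖ ≤ 2 / a.re * Real.exp (-(a.re / 2) * x) := by
  rw [norm_mul, Complex.norm_real, Real.norm_eq_abs, abs_of_nonneg hx, Complex.norm_exp]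
  have h1 : a.re / 2 * x ≤ Real.exp (a.re / 2 * x) := by
    linarith [Real.add_one_le_exp (a.re / 2 * x)]
  have h2 : (-a * x : ℂ).re = -(a.re / 2) * x + -(a.re / 2 * x) := by simp; ring
  rw [h2, Real.exp_add, Real.exp_neg (a.re / 2 * x)]
  have h3 := Real.exp_pos (a.re / 2 * x)
  have h4 := Real.exp_pos (-(a.re / 2) * x)
  rw [← mul_assoc, ← div_eq_mul_inv, div_le_iff₀ h3]
  calc x * Real.exp (-(a.re / 2) * x)
      = 2 / a.re * Real.exp (-(a.re / 2) * x) * (a.re / 2 * x) := by field_simp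
    _ ≤ _ := by gcongr

lemma integrableOn_mul_cexp_Ioi (ha : 0 < a.re) :
    IntegrableOn (fun x : ℝ => (x : ℂ) * Complex.exp (-a * x)) (Set.Ioi 0) := by
  refine Integrable.mono' ((integrableOn_exp_mul_Ioi (a := -(a.re / 2)) (by linarith) 0).const_mul
    (2 / a.re)) (Continuous.aestronglyMeasurable (by fun_prop)) ?_
  filter_upwards [ae_restrict_mem measurableSet_Ioi] with x hx
  exact norm_mul_cexp_le ha (le_of_lt hx)

lemma integral_mul_cexp_Ioi (ha : 0 < a.re) :
    ∫ x in Set.Ioi (0 : ℝ), (x : ℂ) * Complex.exp (-a * x) = 1 / a ^ 2 := by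
  have ha0 : a ≠ 0 := by rintro rfl; simp at ha
  have hd : ∀ x ∈ Set.Ici (0 : ℝ), HasDerivAt
      (fun x : ℝ => -(1 / a) * ((x : ℂ) * Complex.exp (-a * x)) -
        1 / a ^ 2 * Complex.exp (-a * x)) ((x : ℂ) * Complex.exp (-a * x)) x := by
    intro x _
    have h0 : HasDerivAt (fun x : ℝ => (x : ℂ)) 1 x := Complex.ofRealCLM.hasDerivAt
    have h1 := (h0.const_mul (-a)).cexp
    refine (((h0.mul h1).const_mul (-(1 / a))).sub (h1.const_mul (1 / a ^ 2))).congr_deriv ?_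
    field_simp; ring
  have hexp : Tendsto (fun x : ℝ => Real.exp (-(a.re / 2) * x)) atTop (𝓝 0) :=
    Real.tendsto_exp_atBot.comp (tendsto_id.const_mul_atTop_of_neg (by linarith))
  have l1 : Tendsto (fun x : ℝ => (x : ℂ) * Complex.exp (-a * x)) atTop (𝓝 0) := by
    refine squeeze_zero_norm' ?_ (mul_zero (2 / a.re) ▸ hexp.const_mul (2 / a.re))
    filter_upwards [eventually_ge_atTop 0] with x hx using norm_mul_cexp_le ha hx
  have l2 : Tendsto (fun x : ℝ => Complex.exp (-a * x)) atTop (𝓝 0) := by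
    refine squeeze_zero_norm' ?_ hexp
    filter_upwards [eventually_ge_atTop 0] with x hx
    rw [Complex.norm_exp]
    refine Real.exp_le_exp.2 ?_
    have : 0 ≤ a.re * x := by positivity
    simp; linarith
  have lim := (l1.const_mul (-(1 / a))).sub (l2.const_mul (1 / a ^ 2))
  rw [integral_Ioi_of_hasDerivAt_of_tendsto' hd (integrableOn_mul_cexp_Ioi ha) lim]
  simp

/-- The two half-lines contribute the conjugate values `1 / (2π (κ ± iθ))²`, whose sum is twice a
real part. -/
lemma integral_abs_mul_cexp {κ : ℝ} (hκ : 0 < κ) (θ : ℝ) :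
    ∫ u : ℝ, ((|u| : ℝ) : ℂ) * Complex.exp (-(2 * Real.pi * (κ * |u| : ℝ)) -
        2 * Real.pi * Complex.I * u * θ) =
      ((1 / (2 * Real.pi ^ 2) * (1 / ((κ : ℂ) - Complex.I * θ) ^ 2).re : ℝ) : ℂ) := by
  have hπ := Real.pi_pos
  have n1 : ((κ : ℂ) - Complex.I * θ) ≠ 0 := by
    intro h; have := congrArg Complex.re h; simp at this; exact hκ.ne' this
  have n2 : ((κ : ℂ) + Complex.I * θ) ≠ 0 := by
    intro h; have := congrArg Complex.re h; simp at this; exact hκ.ne' this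
  have hπ' : (Real.pi : ℂ) ≠ 0 := by exact_mod_cast hπ.ne'
  set f : ℝ → ℂ := fun u => ((|u| : ℝ) : ℂ) * Complex.exp (-(2 * Real.pi * (κ * |u| : ℝ)) -
        2 * Real.pi * Complex.I * u * θ) with hf
  have r1 : 0 < (2 * Real.pi * (κ + Complex.I * θ) : ℂ).re := by simp; positivity
  have r2 : 0 < (2 * Real.pi * (κ - Complex.I * θ) : ℂ).re := by simp; positivity
  have e1 : ∀ u ∈ Set.Ioi (0 : ℝ), f u =
      (u : ℂ) * Complex.exp (-(2 * Real.pi * (κ + Complex.I * θ)) * u) := by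
    intro u hu
    simp only [hf, abs_of_pos (Set.mem_Ioi.1 hu)]
    congr 2; push_cast; ring
  have e2 : ∀ u ∈ Set.Ioi (0 : ℝ), f (-u) =
      (u : ℂ) * Complex.exp (-(2 * Real.pi * (κ - Complex.I * θ)) * u) := by
    intro u hu
    simp only [hf, abs_neg, abs_of_pos (Set.mem_Ioi.1 hu)]
    congr 2; push_cast; ring
  have i1 : ∫ u in Set.Ioi (0 : ℝ), f u = 1 / (2 * Real.pi * (κ + Complex.I * θ)) ^ 2 := by
    rw [setIntegral_congr_fun measurableSet_Ioi e1, integral_mul_cexp_Ioi r1]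
  have i2 : ∫ u in Set.Iic (0 : ℝ), f u = 1 / (2 * Real.pi * (κ - Complex.I * θ)) ^ 2 := by
    rw [← neg_zero, ← integral_comp_neg_Ioi, setIntegral_congr_fun measurableSet_Ioi e2,
      integral_mul_cexp_Ioi r2]
  -- A non-integrable function has integral `0` by convention, so a nonzero value proves
  -- integrability.
  have c1 : IntegrableOn f (Set.Ioi 0) := Integrable.of_integral_ne_zero (by
    rw [i1]; exact one_div_ne_zero (pow_ne_zero _ (by simp [hπ', n2])))
  have c2 : IntegrableOn f (Set.Iic 0) := Integrable.of_integral_ne_zero (by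
    rw [i2]; exact one_div_ne_zero (pow_ne_zero _ (by simp [hπ', n1])))
  rw [← intervalIntegral.integral_Iic_add_Ioi c2 c1, i1, i2]
  rw [Complex.ofReal_mul, Complex.re_eq_add_conj]
  simp only [map_div₀, map_one, map_pow, map_sub, map_mul, Complex.conj_ofReal, Complex.conj_I]
  rw [show (κ : ℂ) - -Complex.I * θ = κ + Complex.I * θ by ring]
  push_cast
  field_simp

end Laplace

/-- The Fourier integral of `exp (-2π affineNorm)`, reduced to a single integral by the
substitution `v = u w`. -/
lemma integral_cexp_affineNorm (x₁ x₂ : ℝ) :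
    ∫ p : ℝ × ℝ, Complex.exp (-(2 * Real.pi * affineNorm p.1 p.2) -
        2 * Real.pi * Complex.I * (p.1 * x₁ + p.2 * x₂)) =
      ((1 / (2 * Real.pi ^ 2) * ∫ w : ℝ,
        (1 / ((affineNorm 1 w : ℂ) - Complex.I * ((x₁ + w * x₂ : ℝ) : ℂ)) ^ 2).re : ℝ) : ℂ) := by
  have hπ := Real.pi_pos
  have hcont := continuous_affineNorm
  set F : ℝ × ℝ → ℂ := fun p => Complex.exp (-(2 * Real.pi * affineNorm p.1 p.2) -
        2 * Real.pi * Complex.I * (p.1 * x₁ + p.2 * x₂)) with hF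
  have Fc : Continuous F := by fun_prop
  have Fi : Integrable F (volume.prod volume) := by
    have h := (integrable_exp_neg_mul_abs (c := Real.pi / 5) (by positivity)).mul_prod
      (integrable_exp_neg_mul_abs (c := Real.pi / 5) (by positivity))
    refine h.mono' Fc.aestronglyMeasurable (ae_of_all _ fun p => ?_)
    rw [hF, Complex.norm_exp, ← Real.exp_add]
    refine Real.exp_le_exp.2 ?_
    have := mul_le_mul_of_nonneg_left (abs_add_abs_le_affineNorm p.1 p.2) hπ.le
    simp
    linarith
  -- `G` is `F` after `v = u w`, with Jacobian `|u|`. Its integrability is inherited from `F`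
  -- fibrewise and justifies integrating in `u` first.
  set G : ℝ × ℝ → ℂ := fun p => ((|p.1| : ℝ) : ℂ) * F (p.1, p.1 * p.2) with hG
  have Gc : Continuous G := by fun_prop
  have hae : ∀ᵐ u : ℝ, u ≠ 0 := by
    simp [ae_iff, measure_singleton]
  have sub : ∀ u : ℝ, u ≠ 0 → ∫ w, G (u, w) = ∫ v, F (u, v) := by
    intro u hu
    simp only [hG]
    rw [integral_const_mul, Measure.integral_comp_mul_left (fun v => F (u, v)) u,
      abs_inv, Complex.real_smul, ← mul_assoc, ← Complex.ofReal_mul,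
      mul_inv_cancel₀ (abs_ne_zero.2 hu), Complex.ofReal_one, one_mul]
  have subn : ∀ u : ℝ, u ≠ 0 → ∫ w, ‖G (u, w)‖ = ∫ v, ‖F (u, v)‖ := by
    intro u hu
    simp only [hG, norm_mul, Complex.norm_real, Real.norm_eq_abs, abs_abs]
    rw [integral_const_mul, Measure.integral_comp_mul_left (fun v => ‖F (u, v)‖) u,
      abs_inv, smul_eq_mul, ← mul_assoc, mul_inv_cancel₀ (abs_ne_zero.2 hu), one_mul]
  have Gi : Integrable G (volume.prod volume) := by
    refine (integrable_prod_iff Gc.aestronglyMeasurable).2 ⟨?_, ?_⟩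
    · filter_upwards [hae, Fi.prod_right_ae] with u hu hFu
      exact (hFu.comp_mul_left' hu).const_mul ((|u| : ℝ) : ℂ)
    · refine Fi.integral_norm_prod_left.congr ?_
      filter_upwards [hae] with u hu using (subn u hu).symm
  have : ∫ p, F p = ∫ u, ∫ v, F (u, v) := integral_prod _ Fi
  rw [this, ← integral_congr_ae (hae.mono fun u hu => sub u hu), integral_integral_swap Gi,
    ← integral_const_mul, ← integral_complex_ofReal]
  refine integral_congr_ae (ae_of_all _ fun w => ?_)
  beta_reduce
  rw [← integral_abs_mul_cexp (affineNorm_one_pos w)]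
  refine integral_congr_ae (ae_of_all _ fun u => ?_)
  simp only [hG, hF]
  have e := affineNorm_mul u 1 w
  rw [mul_one] at e
  rw [e]
  congr 2; push_cast; ring

lemma integrable_one_div_affineNorm_sub_sq (x₁ x₂ : ℝ) :
    Integrable (fun w : ℝ =>
      1 / ((affineNorm 1 w : ℂ) - Complex.I * ((x₁ + w * x₂ : ℝ) : ℂ)) ^ 2) := by
  have hc : Continuous fun w : ℝ => affineNorm 1 w :=
    continuous_affineNorm.comp (by fun_prop : Continuous fun w : ℝ => ((1 : ℝ), w))
  have ne : ∀ w : ℝ, ((affineNorm 1 w : ℂ) - Complex.I * ((x₁ + w * x₂ : ℝ) : ℂ)) ≠ 0 := by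
    intro w h; have := congrArg Complex.re h; simp at this; exact (affineNorm_one_pos w).ne' this
  -- The denominator has modulus at least `affineNorm 1 w ≥ (1 + |w|) / 10`; squaring gives the
  -- constant `100`.
  refine (integrable_inv_one_add_sq.const_mul 100).mono'
    (Continuous.aestronglyMeasurable ?_) (ae_of_all _ fun w => ?_)
  · refine continuous_const.div (by fun_prop) fun w => pow_ne_zero _ (ne w)
  · have h1 : affineNorm 1 w ≤ ‖(affineNorm 1 w : ℂ) - Complex.I * ((x₁ + w * x₂ : ℝ) : ℂ)‖ := by
      refine le_trans (le_of_eq ?_) (Complex.re_le_norm _)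
      simp
    have h2 := abs_add_abs_le_affineNorm 1 w
    rw [abs_one] at h2
    have h3 : 1 + w ^ 2 ≤ 100 * ‖(affineNorm 1 w : ℂ) - Complex.I * ((x₁ + w * x₂ : ℝ) : ℂ)‖ ^ 2 := by
      have := abs_nonneg w
      rw [← sq_abs w]
      nlinarith
    rw [norm_div, norm_one, norm_pow, ← div_eq_mul_inv, div_le_div_iff₀
      (by have := norm_pos_iff.2 (ne w); positivity) (by positivity)]
    linarith

/-- The quadratic polynomial occurring in the integral over the sector where `u` and `u + v` have
opposite signs. -/
noncomputable def cauchyQuad (x₁ x₂ : ℝ) (t : ℝ) : ℂ :=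
  (t : ℂ) ^ 2 - t + 1 / 2 - Complex.I * (x₁ * t - x₂)

lemma re_cauchyQuad_pos (x₁ x₂ t : ℝ) : 0 < (cauchyQuad x₁ x₂ t).re := by
  have : (cauchyQuad x₁ x₂ t).re = (t - 1 / 2) ^ 2 + 1 / 4 := by
    simp [cauchyQuad, ← Complex.ofReal_pow]; ring
  rw [this]; positivity

lemma cauchyQuad_ne_zero (x₁ x₂ t : ℝ) : cauchyQuad x₁ x₂ t ≠ 0 := fun h => by
  have := re_cauchyQuad_pos x₁ x₂ t
  simp [h] at this

/-- Split at `w = -1`. To the right the denominator is the square of `α + w β`. To the left it is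
`w² q(-1 / w)²` with `q = cauchyQuad x₁ x₂`, so `w ↦ H (-1 / w)` is an antiderivative, running from
`H 0` to `H 1`. -/
lemma integral_one_div_affineNorm_sub_sq (x₁ x₂ : ℝ) {H : ℝ → ℂ}
    (hH : ∀ t, HasDerivAt H (1 / cauchyQuad x₁ x₂ t ^ 2) t) :
    ∫ w : ℝ, 1 / ((affineNorm 1 w : ℂ) - Complex.I * ((x₁ + w * x₂ : ℝ) : ℂ)) ^ 2 =
      1 / ((1 / 2 - Complex.I * x₂) * cauchyQuad x₁ x₂ 1) + (H 1 - H 0) := by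
  have hi := integrable_one_div_affineNorm_sub_sq x₁ x₂
  set f : ℝ → ℂ := fun w =>
    1 / ((affineNorm 1 w : ℂ) - Complex.I * ((x₁ + w * x₂ : ℝ) : ℂ)) ^ 2 with hf
  rw [← intervalIntegral.integral_Iic_add_Ioi (b := -1) hi.integrableOn hi.integrableOn,
    add_comm]
  set β : ℂ := 1 / 2 - Complex.I * x₂ with hβ
  set α : ℂ := 1 - Complex.I * x₁ with hα
  have hβ0 : β ≠ 0 := by
    intro h; have := congrArg Complex.re h; simp [hβ] at this
  have hαβ : ∀ w : ℝ, -1 ≤ w → α + w * β ≠ 0 := by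
    intro w hw h
    have := congrArg Complex.re h
    simp [hα, hβ] at this
    linarith
  congr 1
  · have hd : ∀ w ∈ Set.Ici (-1 : ℝ), HasDerivAt (fun w : ℝ => -(1 / β) * (α + w * β)⁻¹) (f w) w := by
      intro w hw
      have h0 : HasDerivAt (fun x : ℝ => (x : ℂ)) 1 w := Complex.ofRealCLM.hasDerivAt
      have h1 := (((h0.mul_const β).const_add α).inv (hαβ w hw)).const_mul (-(1 / β))
      refine h1.congr_deriv ?_
      have e : (affineNorm 1 w : ℂ) - Complex.I * ((x₁ + w * x₂ : ℝ) : ℂ) = α + w * β := by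
        rw [affineNorm_one_of_neg_one_le hw, hα, hβ]; push_cast; ring
      have := hαβ w hw
      simp only [hf, e]
      field_simp
    have lim : Tendsto (fun w : ℝ => -(1 / β) * (α + w * β)⁻¹) atTop (𝓝 (-(1 / β) * 0)) := by
      refine Tendsto.const_mul _ (tendsto_inv₀_cobounded.comp ?_)
      refine tendsto_norm_atTop_iff_cobounded.1 ?_
      refine tendsto_atTop_mono (fun w => Complex.re_le_norm _) ?_
      have : (fun w : ℝ => (α + w * β).re) = fun w => 1 + w * (1 / 2) := by
        funext w; simp [hα, hβ]
      rw [this]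
      exact tendsto_atTop_add_const_left _ _ (tendsto_id.atTop_mul_const (by norm_num))
    rw [integral_Ioi_of_hasDerivAt_of_tendsto' hd hi.integrableOn lim]
    have e : α + ((-1 : ℝ) : ℂ) * β = cauchyQuad x₁ x₂ 1 := by
      simp only [hα, hβ, cauchyQuad]; push_cast; ring
    rw [e]
    have := cauchyQuad_ne_zero x₁ x₂ 1
    field_simp
    ring
  · have hd : ∀ w ∈ Set.Iio (-1 : ℝ), HasDerivAt (fun w : ℝ => H (-1 / w)) (f w) w := by
      intro w hw
      have hw' : w < -1 := hw
      have hw0 : w ≠ 0 := by linarith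
      have h1 : HasDerivAt (fun w : ℝ => -1 / w) (1 / w ^ 2) w := by
        refine ((hasDerivAt_inv hw0).const_mul (-1)).congr_deriv ?_
        field_simp
      refine ((hH (-1 / w)).scomp w h1).congr_deriv ?_
      have e : (affineNorm 1 w : ℂ) - Complex.I * ((x₁ + w * x₂ : ℝ) : ℂ) =
          -w * cauchyQuad x₁ x₂ (-1 / w) := by
        have hw0' : (w : ℂ) ≠ 0 := by exact_mod_cast hw0
        rw [affineNorm_one_of_lt_neg_one hw', cauchyQuad]; push_cast
        field_simp
        ring
      simp only [hf, e, Complex.real_smul]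
      push_cast
      rw [mul_pow, neg_sq]
      field_simp
    have hcont : ContinuousWithinAt (fun w : ℝ => H (-1 / w)) (Set.Iic (-1)) (-1) := by
      refine ContinuousAt.continuousWithinAt (ContinuousAt.comp ?_ ?_)
      · exact (hH _).continuousAt
      · exact continuousAt_const.div continuousAt_id (by norm_num)
    have lim : Tendsto (fun w : ℝ => H (-1 / w)) atBot (𝓝 (H 0)) := by
      refine ((hH 0).continuousAt.tendsto).comp ?_
      exact tendsto_const_nhds.div_atBot tendsto_id
    rw [integral_Iic_of_hasDerivAt_of_tendsto hcont hd hi.integrableOn lim]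
    norm_num

/-! ### The complex arctangent and its branch cuts -/

section Arctan

open Complex in
/-- Off the branch cuts, the argument of the logarithm defining `arctan` lies in the slit plane. -/
lemma arctan_arg_mem_slitPlane {z : ℂ}
    (h : ∀ r : ℝ, 0 ≤ r → z ^ 2 * (r - 1) ^ 2 + (1 + r) ^ 2 ≠ 0) :
    1 - z * I ≠ 0 ∧ 1 + z * I ≠ 0 ∧ (1 + z * I) / (1 - z * I) ∈ slitPlane := by
  have h0 := h 0 le_rfl
  have fac : (1 - z * I) * (1 + z * I) = z ^ 2 * ((0 : ℝ) - 1) ^ 2 + (1 + (0 : ℝ)) ^ 2 := by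
    push_cast; linear_combination -z ^ 2 * I_sq
  have h1 : 1 - z * I ≠ 0 := by
    intro h'; rw [← fac, h', zero_mul] at h0; exact h0 rfl
  have h2 : 1 + z * I ≠ 0 := by
    intro h'; rw [← fac, h', mul_zero] at h0; exact h0 rfl
  refine ⟨h1, h2, ?_⟩
  -- Otherwise the quotient equals `-r` with `r ≥ 0`, that is `z I (1 - r) = -(1 + r)`; squaring
  -- contradicts `h r`.
  by_contra hs
  rw [mem_slitPlane_iff_not_le_zero, not_not] at hs
  set r : ℝ := -((1 + z * I) / (1 - z * I)).re with hr
  have e : (1 + z * I) / (1 - z * I) = -(r : ℂ) := by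
    rw [hr, ofReal_neg, neg_neg]
    refine Complex.ext (by simp) ?_
    rw [(Complex.le_def.1 hs).2]; simp
  have hr0 : 0 ≤ r := by
    have := (Complex.le_def.1 hs).1
    simp only [zero_re] at this
    linarith
  rw [div_eq_iff h1] at e
  apply h r hr0
  linear_combination ((1 + r) + z * I * (r - 1)) * e + z ^ 2 * (r - 1) ^ 2 * I_sq

open Complex in
lemma hasDerivAt_arctan {z : ℂ}
    (h : ∀ r : ℝ, 0 ≤ r → z ^ 2 * (r - 1) ^ 2 + (1 + r) ^ 2 ≠ 0) :
    HasDerivAt arctan (1 / (1 + z ^ 2)) z := by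
  obtain ⟨h1, h2, h3⟩ := arctan_arg_mem_slitPlane h
  have d := ((((((hasDerivAt_id' z).mul_const I).const_add 1).div
    (((hasDerivAt_id' z).mul_const I).const_sub 1) h1).clog h3).const_mul (-I / 2))
  refine d.congr_deriv ?_
  have fac : 1 + z ^ 2 = (1 - z * I) * (1 + z * I) := by linear_combination z ^ 2 * I_sq
  have num : 1 * I * (1 - z * I) - (1 + z * I) * -(1 * I) = 2 * I := by ring
  rw [fac, Pi.div_apply, num]
  generalize 1 - z * I = p at *
  generalize 1 + z * I = q at *
  field_simp
  linear_combination (-1 : ℂ) * I_sq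

open Complex in
lemma cexp_two_mul_I_mul_arctan {z : ℂ} (h1 : 1 - z * I ≠ 0) (h2 : 1 + z * I ≠ 0) :
    exp (2 * I * arctan z) = (1 + z * I) / (1 - z * I) := by
  have : 2 * I * arctan z = log ((1 + z * I) / (1 - z * I)) := by
    rw [arctan]; linear_combination -log ((1 + z * I) / (1 - z * I)) * I_sq
  rw [this, exp_log (div_ne_zero h2 h1)]

open Complex in
/-- `arctan z⁻¹ = π / 2 - arctan z` in the right half plane. -/
lemma arctan_inv_of_re_pos {z : ℂ} (hz : 0 < z.re) (h1 : 1 - z * I ≠ 0) (h2 : 1 + z * I ≠ 0) :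
    arctan z⁻¹ = Real.pi / 2 - arctan z := by
  have hz0 : z ≠ 0 := by rintro rfl; simp at hz
  set w : ℂ := (1 + z * I) / (1 - z * I) with hw
  have e : (1 + z⁻¹ * I) / (1 - z⁻¹ * I) = -w⁻¹ := by
    have h3 : z - I ≠ 0 := by
      intro h; apply h2; linear_combination I * h + I_sq
    rw [hw, inv_div, div_eq_iff, ← neg_div, div_mul_eq_mul_div, eq_div_iff h2]
    · field_simp
      linear_combination (2 * z) * I_sq
    · intro h; apply h3
      field_simp at h
      linear_combination h
  -- This is where `0 < z.re` enters: it fixes the sign of `π` in the logarithm of `-w⁻¹`.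
  have him : (w⁻¹).im < 0 := by
    rw [hw, inv_div, div_im]
    simp only [sub_im, one_im, mul_im, I_re, I_im, add_im, add_re, sub_re, one_re, mul_re]
    rw [← sub_div]
    refine div_neg_of_neg_of_pos ?_ (normSq_pos.2 h2)
    ring_nf
    linarith
  have hw0 : w ≠ 0 := div_ne_zero h2 h1
  have hlog : log (-w⁻¹) = -log w + Real.pi * I := by
    have harg : w.arg ≠ Real.pi := by
      intro h
      have := (arg_eq_pi_iff.1 h).2
      rw [inv_im, this] at him
      simp at him
    rw [← log_inv w harg, log, log, norm_neg, arg_neg_eq_arg_add_pi_of_im_neg him]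
    push_cast; ring
  rw [arctan, arctan, e, hlog]
  linear_combination -(Real.pi : ℂ) / 2 * I_sq

end Arctan

/-! ### Closed evaluation of the integral -/

section Evaluation

open Complex

lemma re_cauchyQ (x₁ x₂ : ℝ) : (cauchyQ x₁ x₂).re = 1 + x₁ ^ 2 := by
  simp [cauchyQ, ← ofReal_pow]

lemma im_cauchyQ (x₁ x₂ : ℝ) : (cauchyQ x₁ x₂).im = -2 * (x₁ - 2 * x₂) := by
  simp [cauchyQ, ← ofReal_pow]; ring

lemma cauchyQ_mem_slitPlane (x₁ x₂ : ℝ) : cauchyQ x₁ x₂ ∈ slitPlane :=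
  Or.inl (by rw [re_cauchyQ]; positivity)

lemma cauchyQ_ne_zero (x₁ x₂ : ℝ) : cauchyQ x₁ x₂ ≠ 0 :=
  slitPlane_ne_zero (cauchyQ_mem_slitPlane x₁ x₂)

/-- The principal square root of `cauchyQ`. -/
noncomputable def cauchyRoot (x₁ x₂ : ℝ) : ℂ := cauchyQ x₁ x₂ ^ (1 / 2 : ℂ)

lemma cauchyRoot_sq (x₁ x₂ : ℝ) : cauchyRoot x₁ x₂ ^ 2 = cauchyQ x₁ x₂ := by
  rw [cauchyRoot, ← cpow_nat_mul]; norm_num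

lemma cauchyRoot_ne_zero (x₁ x₂ : ℝ) : cauchyRoot x₁ x₂ ≠ 0 := fun h => by
  have := cauchyRoot_sq x₁ x₂
  rw [h] at this
  exact cauchyQ_ne_zero x₁ x₂ (by rw [← this]; norm_num)

lemma cauchyQ_cpow_three_halves (x₁ x₂ : ℝ) :
    cauchyQ x₁ x₂ ^ (3 / 2 : ℂ) = cauchyQ x₁ x₂ * cauchyRoot x₁ x₂ := by
  rw [show (3 / 2 : ℂ) = 1 + 1 / 2 by norm_num, cpow_add _ _ (cauchyQ_ne_zero x₁ x₂), cpow_one,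
    cauchyRoot]

lemma re_cauchyRoot_pos (x₁ x₂ : ℝ) : 0 < (cauchyRoot x₁ x₂).re := by
  have hQ := cauchyQ_ne_zero x₁ x₂
  rw [cauchyRoot, cpow_def_of_ne_zero hQ, exp_re]
  refine mul_pos (Real.exp_pos _) (Real.cos_pos_of_mem_Ioo ?_)
  have e : (log (cauchyQ x₁ x₂) * (1 / 2)).im = (cauchyQ x₁ x₂).arg / 2 := by
    rw [mul_im, log_im]; norm_num; ring
  have hpi := Real.pi_pos
  have h1 := neg_pi_lt_arg (cauchyQ x₁ x₂)
  have h2 := arg_le_pi (cauchyQ x₁ x₂)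
  have h3 : (cauchyQ x₁ x₂).arg ≠ Real.pi := slitPlane_arg_ne_pi (cauchyQ_mem_slitPlane x₁ x₂)
  have h4 := lt_of_le_of_ne h2 h3
  rw [e]
  constructor <;> linarith

/-- The points `2 (σ - i x₁ / 2) / √Q` lie off the branch cuts of `arctan`. -/
lemma arctan_cut_endpoint (x₁ x₂ σ : ℝ) (r : ℝ) (hr : 0 ≤ r) :
    (2 * (σ - I * x₁ / 2) / cauchyRoot x₁ x₂) ^ 2 * (r - 1) ^ 2 + (1 + r : ℂ) ^ 2 ≠ 0 := by
  have hQ := cauchyQ_ne_zero x₁ x₂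
  rw [div_pow, cauchyRoot_sq]
  intro h
  field_simp at h
  have h' : (2 * (σ - I * x₁ / 2)) ^ 2 * (r - 1) ^ 2 + cauchyQ x₁ x₂ * (1 + r : ℂ) ^ 2 = 0 := by
    linear_combination h
  -- The negative term `-x₁² (r - 1)²` is compensated by `x₁² (1 + r)²` from the real part of `Q`,
  -- leaving `4 x₁² r ≥ 0`.
  have e : ((2 * (σ - I * x₁ / 2)) ^ 2 * (r - 1) ^ 2 + cauchyQ x₁ x₂ * (1 + r : ℂ) ^ 2).re =
      4 * σ ^ 2 * (r - 1) ^ 2 + (1 + r) ^ 2 + 4 * x₁ ^ 2 * r := by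
    have e1 : ((2 * (σ - I * x₁ / 2)) ^ 2 * (r - 1) ^ 2 : ℂ) =
        (((4 * σ ^ 2 - x₁ ^ 2) * (r - 1) ^ 2 : ℝ) : ℂ) +
          ((-4 * σ * x₁ * (r - 1) ^ 2 : ℝ) : ℂ) * I := by
      push_cast; linear_combination (x₁ : ℂ) ^ 2 * (r - 1) ^ 2 * I_sq
    have e2 : (1 + r : ℂ) ^ 2 = (((1 + r) ^ 2 : ℝ) : ℂ) := by push_cast; ring
    rw [e1, e2, add_re, add_re, re_mul_ofReal, re_cauchyQ, ofReal_re, re_ofReal_mul, I_re]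
    ring
  rw [h'] at e
  simp only [zero_re] at e
  have : 0 < (1 + r) ^ 2 := by positivity
  have h2 : 0 ≤ 4 * σ ^ 2 * (r - 1) ^ 2 := by positivity
  have h3 : 0 ≤ 4 * x₁ ^ 2 * r := by positivity
  linarith

/-- After multiplication by `Q`, vanishing of the imaginary part forces `x₁ = 2 x₂`, and then the
real part is `(1 + x₁²) (1 + r)² > 0`. -/
lemma arctan_cut_zeta (x₁ x₂ : ℝ) (r : ℝ) (hr : 0 ≤ r) :
    (-I * (x₁ - 2 * x₂) / cauchyRoot x₁ x₂) ^ 2 * (r - 1) ^ 2 + (1 + r : ℂ) ^ 2 ≠ 0 := by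
  have hQ := cauchyQ_ne_zero x₁ x₂
  rw [div_pow, cauchyRoot_sq]
  intro h
  field_simp at h
  have h' : ((-(x₁ - 2 * x₂) ^ 2 * (r - 1) ^ 2 : ℝ) : ℂ) +
      cauchyQ x₁ x₂ * (((1 + r) ^ 2 : ℝ) : ℂ) = 0 := by
    push_cast
    linear_combination h - ((x₁ : ℂ) - 2 * x₂) ^ 2 * (r - 1) ^ 2 * I_sq
  have hp : 0 < (1 + r) ^ 2 := by positivity
  have him := congrArg Complex.im h'
  rw [add_im, ofReal_im, im_mul_ofReal, im_cauchyQ, zero_add, zero_im] at him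
  have hc : x₁ - 2 * x₂ = 0 := by
    rcases mul_eq_zero.1 him with h | h
    · linarith
    · exact absurd h hp.ne'
  have hre := congrArg Complex.re h'
  rw [hc, add_re, ofReal_re, re_mul_ofReal, re_cauchyQ, zero_re] at hre
  have : 0 < (1 + x₁ ^ 2) * (1 + r) ^ 2 := by positivity
  simp at hre
  rcases hre with h | h
  · have : 0 < 1 + x₁ ^ 2 := by positivity
    linarith
  · linarith

lemma differentiableAt_cauchyRoot_line (x₁ x₂ l : ℝ) :
    DifferentiableAt ℝ (fun l : ℝ => cauchyRoot (l * x₁) (l * x₂)) l := by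
  unfold cauchyRoot
  have hQ : DifferentiableAt ℝ (fun l : ℝ => cauchyQ (l * x₁) (l * x₂)) l := by
    unfold cauchyQ
    have : DifferentiableAt ℝ (fun l : ℝ => (l : ℂ)) l := ofRealCLM.differentiableAt
    push_cast
    fun_prop
  have h := (((hasDerivAt_id' (cauchyQ (l * x₁) (l * x₂))).cpow_const
    (c := (1 / 2 : ℂ)) (cauchyQ_mem_slitPlane _ _)).differentiableAt.restrictScalars ℝ)
  exact h.comp l hQ

/-- The addition formula for the three arctangents occurring in the density, without a jump of the
branch. -/
lemma arctan_sub_arctan_eq (x₁ x₂ : ℝ) :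
    arctan (2 * ((1 / 2 : ℝ) - I * x₁ / 2) / cauchyRoot x₁ x₂) -
      arctan (2 * ((-1 / 2 : ℝ) - I * x₁ / 2) / cauchyRoot x₁ x₂) =
      Real.pi / 2 - arctan (-I * (x₁ - 2 * x₂) / cauchyRoot x₁ x₂) := by
  set A : ℝ → ℝ → ℂ := fun σ l =>
    2 * (σ - I * ((l * x₁ : ℝ) : ℂ) / 2) / cauchyRoot (l * x₁) (l * x₂) with hA
  set Z : ℝ → ℂ := fun l =>
    -I * (((l * x₁ : ℝ) : ℂ) - 2 * ((l * x₂ : ℝ) : ℂ)) / cauchyRoot (l * x₁) (l * x₂) with hZ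
  -- The defect is followed along the segment from the origin to `(x₁, x₂)`. All three arguments
  -- avoid the cuts, so `d` is differentiable; as `exp (2 i d) = -1` throughout, `d` is constant.
  set d : ℝ → ℂ := fun l => arctan (A (1 / 2) l) - arctan (A (-1 / 2) l) + arctan (Z l) with hd
  have hof : ∀ l : ℝ, DifferentiableAt ℝ (fun l : ℝ => (l : ℂ)) l :=
    fun l => ofRealCLM.differentiableAt
  have dA : ∀ σ l, DifferentiableAt ℝ (A σ) l := by
    intro σ l
    have h1 := differentiableAt_cauchyRoot_line x₁ x₂ l
    have h2 := cauchyRoot_ne_zero (l * x₁) (l * x₂)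
    have := hof l
    simp only [hA]
    push_cast
    fun_prop (disch := assumption)
  have dZ : ∀ l, DifferentiableAt ℝ Z l := by
    intro l
    have h1 := differentiableAt_cauchyRoot_line x₁ x₂ l
    have h2 := cauchyRoot_ne_zero (l * x₁) (l * x₂)
    have := hof l
    simp only [hZ]
    push_cast
    fun_prop (disch := assumption)
  have cA : ∀ σ l, ∀ r : ℝ, 0 ≤ r → A σ l ^ 2 * (r - 1) ^ 2 + (1 + r : ℂ) ^ 2 ≠ 0 :=
    fun σ l r hr => arctan_cut_endpoint (l * x₁) (l * x₂) σ r hr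
  have cZ : ∀ l, ∀ r : ℝ, 0 ≤ r → Z l ^ 2 * (r - 1) ^ 2 + (1 + r : ℂ) ^ 2 ≠ 0 :=
    fun l r hr => arctan_cut_zeta (l * x₁) (l * x₂) r hr
  have dd : Differentiable ℝ d := fun l =>
    ((((hasDerivAt_arctan (cA (1 / 2) l)).differentiableAt.restrictScalars ℝ).comp l (dA _ l)).sub
      (((hasDerivAt_arctan (cA (-1 / 2) l)).differentiableAt.restrictScalars ℝ).comp l
        (dA _ l))).add
      (((hasDerivAt_arctan (cZ l)).differentiableAt.restrictScalars ℝ).comp l (dZ l))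
  have hexp : ∀ l, exp (2 * I * d l) = -1 := by
    intro l
    obtain ⟨a1, a2, -⟩ := arctan_arg_mem_slitPlane (cA (1 / 2) l)
    obtain ⟨b1, b2, -⟩ := arctan_arg_mem_slitPlane (cA (-1 / 2) l)
    obtain ⟨z1, z2, -⟩ := arctan_arg_mem_slitPlane (cZ l)
    have e : 2 * I * d l = 2 * I * arctan (A (1 / 2) l) - 2 * I * arctan (A (-1 / 2) l) +
        2 * I * arctan (Z l) := by simp only [hd]; ring
    rw [e, Complex.exp_add, Complex.exp_sub, cexp_two_mul_I_mul_arctan a1 a2,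
      cexp_two_mul_I_mul_arctan b1 b2, cexp_two_mul_I_mul_arctan z1 z2]
    have hR := cauchyRoot_ne_zero (l * x₁) (l * x₂)
    -- This says that the denominator in the tangent addition formula for the three angles vanishes.
    have key : A (1 / 2) l * Z l - A (1 / 2) l * A (-1 / 2) l - Z l * A (-1 / 2) l = 1 := by
      have hsq := cauchyRoot_sq (l * x₁) (l * x₂)
      simp only [hA, hZ]
      rw [cauchyQ] at hsq
      field_simp
      rw [hsq]
      push_cast
      linear_combination (-(l : ℂ) ^ 2 * x₁ ^ 2) * I_sq
    have prod : (1 + A (1 / 2) l * I) * (1 - A (-1 / 2) l * I) * (1 + Z l * I) =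
        -((1 - A (1 / 2) l * I) * (1 + A (-1 / 2) l * I) * (1 - Z l * I)) := by
      linear_combination (-2 : ℂ) * key + 2 *
        (A (1 / 2) l * Z l - A (1 / 2) l * A (-1 / 2) l - Z l * A (-1 / 2) l) * I_sq
    rw [div_div_div_eq, div_mul_div_comm, prod, neg_div, div_self]
    exact mul_ne_zero (mul_ne_zero a1 b2) z1
  have hconst : ∀ l, deriv d l = 0 := by
    intro l
    have h1 := ((dd l).hasDerivAt.const_mul (2 * I)).cexp
    have h2 : (fun l => exp (2 * I * d l)) = fun _ => -1 := funext hexp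
    rw [h2] at h1
    have h3 := h1.unique (hasDerivAt_const l (-1 : ℂ))
    rw [hexp] at h3
    simpa using h3
  have h01 := is_const_of_deriv_eq_zero dd hconst 1 0
  have hR0 : cauchyRoot 0 0 = 1 := by simp [cauchyRoot, cauchyQ]
  have h0 : d 0 = Real.pi / 2 := by
    simp only [hd, hA, hZ, zero_mul, hR0]
    have e1 : arctan 1 = ((Real.pi / 4 : ℝ) : ℂ) := by
      rw [← Real.arctan_one, ofReal_arctan, ofReal_one]
    have e2 : arctan (-1) = ((-(Real.pi / 4) : ℝ) : ℂ) := by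
      rw [← Real.arctan_one, ← Real.arctan_neg, ofReal_arctan, ofReal_neg, ofReal_one]
    have e3 : arctan 0 = 0 := by simp [arctan]
    have f1 : (2 * (((1 / 2 : ℝ) : ℂ) - I * ((0 : ℝ) : ℂ) / 2) / 1 : ℂ) = 1 := by
      push_cast; ring
    have f2 : (2 * (((-1 / 2 : ℝ) : ℂ) - I * ((0 : ℝ) : ℂ) / 2) / 1 : ℂ) = -1 := by
      push_cast; ring
    have f3 : (-I * (((0 : ℝ) : ℂ) - 2 * ((0 : ℝ) : ℂ)) / 1 : ℂ) = 0 := by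
      push_cast; ring
    rw [f1, f2, f3, e1, e2, e3]
    push_cast; ring
  rw [h0] at h01
  simp only [hd, hA, hZ, one_mul] at h01
  rw [← h01]
  ring

/-- The imaginary part of `R² = Q` gives `x₁ - 2 x₂ = -(Re R) (Im R)`, so the real part in question
is `Re R (Im R)² / |R|²`. -/
lemma re_zeta_pos {x₁ x₂ : ℝ} (h : x₁ ≠ 2 * x₂) :
    0 < (-I * (x₁ - 2 * x₂) / cauchyRoot x₁ x₂).re := by
  have hR := cauchyRoot_ne_zero x₁ x₂
  have hre := re_cauchyRoot_pos x₁ x₂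
  have him := congrArg Complex.im (cauchyRoot_sq x₁ x₂)
  rw [im_cauchyQ, sq, mul_im] at him
  set R := cauchyRoot x₁ x₂
  have hc : x₁ - 2 * x₂ ≠ 0 := sub_ne_zero.2 h
  have hcR : x₁ - 2 * x₂ = -(R.re * R.im) := by linarith
  have hi : R.im ≠ 0 := by
    intro h'; rw [h'] at hcR; simp at hcR; exact hc hcR
  have e : (-I * (x₁ - 2 * x₂) / R : ℂ).re = R.re * R.im ^ 2 / normSq R := by
    rw [show (-I * (x₁ - 2 * x₂) : ℂ) = ((-(x₁ - 2 * x₂) : ℝ) : ℂ) * I by push_cast; ring,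
      div_re, re_ofReal_mul, im_ofReal_mul, I_re, I_im, hcR]
    ring
  rw [e]
  have := normSq_pos.2 hR
  positivity

/-- An antiderivative of `1 / cauchyQuad ^ 2`. -/
noncomputable def cauchyPrimitive (x₁ x₂ t : ℝ) : ℂ :=
  2 * (((t - 1 / 2 : ℝ) : ℂ) - I * x₁ / 2) / (cauchyQ x₁ x₂ * cauchyQuad x₁ x₂ t) +
    4 / (cauchyQ x₁ x₂ * cauchyRoot x₁ x₂) *
      arctan (2 * (((t - 1 / 2 : ℝ) : ℂ) - I * x₁ / 2) / cauchyRoot x₁ x₂)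

/-- With `s = t - 1 / 2 - i x₁ / 2`, completing the square gives `4 q = 4 s² + Q`; this is the
standard antiderivative of `(s² + Q / 4)⁻²`. -/
lemma hasDerivAt_cauchyPrimitive (x₁ x₂ t : ℝ) :
    HasDerivAt (cauchyPrimitive x₁ x₂) (1 / cauchyQuad x₁ x₂ t ^ 2) t := by
  have hQ := cauchyQ_ne_zero x₁ x₂
  have hR := cauchyRoot_ne_zero x₁ x₂
  have hsq := cauchyRoot_sq x₁ x₂
  have hq := cauchyQuad_ne_zero x₁ x₂ t
  have h0 : HasDerivAt (fun t : ℝ => (t : ℂ)) 1 t := ofRealCLM.hasDerivAt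
  have hs : HasDerivAt (fun t : ℝ => ((t - 1 / 2 : ℝ) : ℂ) - I * x₁ / 2) 1 t := by
    push_cast
    exact (h0.sub_const _).sub_const _
  have hdq : HasDerivAt (cauchyQuad x₁ x₂) (2 * (((t - 1 / 2 : ℝ) : ℂ) - I * x₁ / 2)) t := by
    have := (((h0.pow 2).sub h0).add_const (1 / 2)).sub
      (((h0.const_mul (x₁ : ℂ)).sub_const (x₂ : ℂ)).const_mul I)
    refine this.congr_deriv ?_
    push_cast; ring
  have hat := (hasDerivAt_arctan (arctan_cut_endpoint x₁ x₂ (t - 1 / 2))).comp t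
    ((hs.const_mul 2).div_const (cauchyRoot x₁ x₂))
  have rel : 4 * cauchyQuad x₁ x₂ t =
      4 * (((t - 1 / 2 : ℝ) : ℂ) - I * x₁ / 2) ^ 2 + cauchyQ x₁ x₂ := by
    rw [cauchyQuad, cauchyQ]; push_cast
    linear_combination (-(x₁ : ℂ) ^ 2) * I_sq
  refine ((((hs.const_mul 2).div (hdq.const_mul (cauchyQ x₁ x₂))
    (mul_ne_zero hQ hq))).add (hat.const_mul (4 / (cauchyQ x₁ x₂ * cauchyRoot x₁ x₂)))).congr_deriv
    ?_
  set s : ℂ := ((t - 1 / 2 : ℝ) : ℂ) - I * x₁ / 2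
  have rel' : 1 + (2 * s / cauchyRoot x₁ x₂) ^ 2 = 4 * cauchyQuad x₁ x₂ t / cauchyQ x₁ x₂ := by
    rw [div_pow, hsq, rel]; field_simp; ring
  rw [rel']
  rw [← hsq] at hQ rel ⊢
  field_simp
  linear_combination rel

/-- The rational part of the density. -/
lemma re_rational_part (x₁ x₂ : ℝ) :
    (1 / ((1 / 2 - I * x₂) * cauchyQuad x₁ x₂ 1) +
      (2 * (((1 / 2 : ℝ) : ℂ) - I * x₁ / 2) / (cauchyQ x₁ x₂ * cauchyQuad x₁ x₂ 1) -
        2 * (((-1 / 2 : ℝ) : ℂ) - I * x₁ / 2) / (cauchyQ x₁ x₂ * cauchyQuad x₁ x₂ 0))).re =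
      8 / (1 + 6 * x₁ ^ 2 + x₁ ^ 4 - 16 * x₁ * x₂ + 16 * x₂ ^ 2) := by
  set N₀ : ℝ := 1 / 4 + x₂ ^ 2 with hN₀
  set N₁ : ℝ := 1 / 4 + (x₁ - x₂) ^ 2 with hN₁
  set M : ℝ := 1 + 6 * x₁ ^ 2 + x₁ ^ 4 - 16 * x₁ * x₂ + 16 * x₂ ^ 2 with hM
  have hM' : M = (1 + x₁ ^ 2) ^ 2 + 4 * (x₁ - 2 * x₂) ^ 2 := by rw [hM]; ring
  have N₀pos : 0 < N₀ := by positivity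
  have N₁pos : 0 < N₁ := by positivity
  have Mpos : 0 < M := by rw [hM']; positivity
  have hQ := cauchyQ_ne_zero x₁ x₂
  have hq₀ := cauchyQuad_ne_zero x₁ x₂ 0
  have hq₁ := cauchyQuad_ne_zero x₁ x₂ 1
  have e₀ : cauchyQuad x₁ x₂ 0 = 1 / 2 + I * x₂ := by simp [cauchyQuad]
  have e₁ : cauchyQuad x₁ x₂ 1 = 1 / 2 - I * (x₁ - x₂) := by simp [cauchyQuad]
  set q₀ := cauchyQuad x₁ x₂ 0
  set q₁ := cauchyQuad x₁ x₂ 1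
  set Q := cauchyQ x₁ x₂ with hQdef
  -- `c₀`, `c₁`, `cQ` are the conjugates of `q₀`, `q₁`, `Q`; they make all denominators real, so
  -- that real parts are taken of polynomials only.
  set c₀ : ℂ := 1 / 2 - I * x₂ with hc₀
  set c₁ : ℂ := 1 / 2 + I * (x₁ - x₂) with hc₁
  set cQ : ℂ := 1 + 2 * I * x₁ + (x₁ : ℂ) ^ 2 - 4 * I * x₂ with hcQ
  have p₀ : q₀ * c₀ = (N₀ : ℂ) := by
    rw [e₀, hc₀, hN₀]; push_cast; linear_combination (-(x₂ : ℂ) ^ 2) * I_sq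
  have p₁ : q₁ * c₁ = (N₁ : ℂ) := by
    rw [e₁, hc₁, hN₁]; push_cast; linear_combination (-((x₁ : ℂ) - x₂) ^ 2) * I_sq
  have pQ : Q * cQ = (M : ℂ) := by
    rw [hQdef, cauchyQ, hcQ, hM]; push_cast
    linear_combination (-(2 * (x₁ : ℂ) - 4 * x₂) ^ 2) * I_sq
  have hN₀' : (N₀ : ℂ) ≠ 0 := by exact_mod_cast N₀pos.ne'
  have hN₁' : (N₁ : ℂ) ≠ 0 := by exact_mod_cast N₁pos.ne'
  have hM'' : (M : ℂ) ≠ 0 := by exact_mod_cast Mpos.ne'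
  have hc₀' : c₀ ≠ 0 := by rintro h; rw [h, mul_zero] at p₀; exact hN₀' p₀.symm
  have hc₁' : c₁ ≠ 0 := by rintro h; rw [h, mul_zero] at p₁; exact hN₁' p₁.symm
  have hcQ' : cQ ≠ 0 := by rintro h; rw [h, mul_zero] at pQ; exact hM'' pQ.symm
  have s₁ : 2 * (((1 / 2 : ℝ) : ℂ) - I * x₁ / 2) = q₁ + c₀ := by
    rw [e₁, hc₀]; push_cast; ring
  have s₀ : 2 * (((-1 / 2 : ℝ) : ℂ) - I * x₁ / 2) = -(q₀ + c₁) := by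
    rw [e₀, hc₁]; push_cast; ring
  have key : 1 / (c₀ * q₁) + ((q₁ + c₀) / (Q * q₁) - -(q₀ + c₁) / (Q * q₀)) =
      ((1 / (N₀ * N₁) : ℝ) : ℂ) * (q₀ * c₁) + ((2 / M : ℝ) : ℂ) * cQ +
        (((N₀ + N₁) / (N₀ * N₁ * M) : ℝ) : ℂ) * (c₀ * c₁ * cQ) := by
    push_cast
    rw [← p₀, ← p₁, ← pQ]
    field_simp
    ring
  rw [s₁, s₀, key, add_re, add_re, re_ofReal_mul, re_ofReal_mul, re_ofReal_mul]
  have r₁ : (q₀ * c₁).re = 1 / 4 - x₂ * (x₁ - x₂) := by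
    rw [e₀, hc₁]; simp; ring
  have r₂ : cQ.re = 1 + x₁ ^ 2 := by
    rw [hcQ]; simp [← ofReal_pow]
  have r₃ : (c₀ * c₁ * cQ).re =
      (1 / 4 + x₂ * (x₁ - x₂)) * (1 + x₁ ^ 2) - (x₁ - 2 * x₂) ^ 2 := by
    rw [hc₀, hc₁, hcQ]; simp [← ofReal_pow]; ring
  rw [r₁, r₂, r₃]
  have n₀ := N₀pos.ne'
  have n₁ := N₁pos.ne'
  have nM := Mpos.ne'
  field_simp
  rw [hN₀, hN₁, hM]
  ring

end Evaluation

/-! ### Joint law and density -/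

section JointLaw

variable {Ω : Type*} [MeasurableSpace Ω] {P : Measure Ω} [IsProbabilityMeasure P]
  {L : ℝ → Ω → ℝ} {X₁ X₂ : Ω → ℝ}

/-- The pair is viewed in `WithLp 2 (ℝ × ℝ)`, because `ℝ × ℝ` carries the sup norm and inversion
needs an inner product. -/
lemma IsCauchyMotion.charFun_map_toLp (hL : IsCauchyMotion P L)
    (h₁ : IsStochIntegral P L 0 1 (fun _ => 1) X₁) (h₂ : IsStochIntegral P L 0 1 (fun z => z) X₂)
    (t : WithLp 2 (ℝ × ℝ)) :
    charFun (P.map (fun ω => WithLp.toLp 2 (X₁ ω, X₂ ω))) t =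
      Complex.exp (-(affineNorm t.fst t.snd : ℝ)) := by
  have m₁ := h₁.1
  have m₂ := h₂.1
  have hm : AEMeasurable (fun ω => WithLp.toLp 2 (X₁ ω, X₂ ω)) P :=
    (WithLp.measurable_toLp 2 (ℝ × ℝ)).comp_aemeasurable (m₁.prodMk m₂)
  have hid : IntegrableOn (fun z : ℝ => z) (Set.Ioc 0 1) :=
    (continuous_id.integrableOn_Icc).mono_set Set.Ioc_subset_Icc_self
  have key := hL.integral_cexp_stochIntegral (integrableOn_const (by simp)) hid h₁ h₂ t.fst t.snd
  rw [charFun_apply, integral_map hm (by fun_prop), affineNorm,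
    intervalIntegral.integral_of_le zero_le_one]
  simp only [mul_one] at key
  rw [← key]
  refine integral_congr_ae (ae_of_all _ fun ω => ?_)
  simp only [WithLp.prod_inner_apply]
  congr 3

lemma integrable_cexp_neg_affineNorm :
    Integrable (fun t : WithLp 2 (ℝ × ℝ) => Complex.exp (-(affineNorm t.fst t.snd : ℝ))) := by
  have hp : Integrable (fun p : ℝ × ℝ => Complex.exp (-(affineNorm p.1 p.2 : ℝ)))
      (volume.prod volume) := by
    have h := (integrable_exp_neg_mul_abs (c := 1 / 10) (by positivity)).mul_prod
      (integrable_exp_neg_mul_abs (c := 1 / 10) (by positivity))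
    have hc := continuous_affineNorm
    refine h.mono' (Continuous.aestronglyMeasurable (by fun_prop)) (ae_of_all _ fun p => ?_)
    rw [Complex.norm_exp, ← Real.exp_add]
    refine Real.exp_le_exp.2 ?_
    have := abs_add_abs_le_affineNorm p.1 p.2
    simp
    linarith
  exact (WithLp.volume_preserving_ofLp (U := ℝ) (V := ℝ)).integrable_comp_of_integrable hp

lemma IsCauchyMotion.charDensity_map_toLp (hL : IsCauchyMotion P L)
    (h₁ : IsStochIntegral P L 0 1 (fun _ => 1) X₁) (h₂ : IsStochIntegral P L 0 1 (fun z => z) X₂)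
    (x₁ x₂ : ℝ) :
    charDensity (P.map (fun ω => WithLp.toLp 2 (X₁ ω, X₂ ω))) (WithLp.toLp 2 (x₁, x₂)) =
      ∫ p : ℝ × ℝ, Complex.exp (-(2 * Real.pi * affineNorm p.1 p.2) -
        2 * Real.pi * Complex.I * (p.1 * x₁ + p.2 * x₂)) := by
  rw [charDensity, Real.fourier_eq', ← (WithLp.volume_preserving_ofLp (U := ℝ)
    (V := ℝ)).integral_comp (MeasurableEquiv.toLp 2 (ℝ × ℝ)).symm.measurableEmbedding]
  refine integral_congr_ae (ae_of_all _ fun t => ?_)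
  beta_reduce
  rw [hL.charFun_map_toLp h₁ h₂, smul_eq_mul, ← Complex.exp_add]
  have e := affineNorm_mul (2 * Real.pi) t.fst t.snd
  rw [abs_of_pos (by positivity)] at e
  simp only [WithLp.prod_inner_apply, WithLp.smul_fst, WithLp.smul_snd, smul_eq_mul, e]
  congr 1
  simp
  ring

/-- The joint density of the two integrals before the elementary evaluation of the arctangent. -/
lemma IsCauchyMotion.re_charDensity_map_toLp (hL : IsCauchyMotion P L)
    (h₁ : IsStochIntegral P L 0 1 (fun _ => 1) X₁) (h₂ : IsStochIntegral P L 0 1 (fun z => z) X₂)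
    (x₁ x₂ : ℝ) :
    (charDensity (P.map (fun ω => WithLp.toLp 2 (X₁ ω, X₂ ω))) (WithLp.toLp 2 (x₁, x₂))).re =
      (4 / Real.pi ^ 2) / (1 + 6 * x₁ ^ 2 + x₁ ^ 4 - 16 * x₁ * x₂ + 16 * x₂ ^ 2) +
        (2 / Real.pi ^ 2) * ((Real.pi / 2 - Complex.arctan
          (-Complex.I * (x₁ - 2 * x₂) / cauchyRoot x₁ x₂)) /
            (cauchyQ x₁ x₂ * cauchyRoot x₁ x₂)).re := by
  have hπ := Real.pi_ne_zero
  rw [hL.charDensity_map_toLp h₁ h₂, integral_cexp_affineNorm, Complex.ofReal_re]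
  have hre : ∫ w : ℝ,
      (1 / ((affineNorm 1 w : ℂ) - Complex.I * ((x₁ + w * x₂ : ℝ) : ℂ)) ^ 2).re =
      (∫ w : ℝ, 1 / ((affineNorm 1 w : ℂ) - Complex.I * ((x₁ + w * x₂ : ℝ) : ℂ)) ^ 2).re :=
    integral_re (integrable_one_div_affineNorm_sub_sq x₁ x₂)
  rw [hre, integral_one_div_affineNorm_sub_sq x₁ x₂ (hasDerivAt_cauchyPrimitive x₁ x₂)]
  have e1 : ((1 : ℝ) - 1 / 2) = 1 / 2 := by norm_num
  have e0 : ((0 : ℝ) - 1 / 2) = -1 / 2 := by norm_num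
  have hsplit : 1 / ((1 / 2 - Complex.I * x₂) * cauchyQuad x₁ x₂ 1) +
      (cauchyPrimitive x₁ x₂ 1 - cauchyPrimitive x₁ x₂ 0) =
      (1 / ((1 / 2 - Complex.I * x₂) * cauchyQuad x₁ x₂ 1) +
      (2 * (((1 / 2 : ℝ) : ℂ) - Complex.I * x₁ / 2) / (cauchyQ x₁ x₂ * cauchyQuad x₁ x₂ 1) -
        2 * (((-1 / 2 : ℝ) : ℂ) - Complex.I * x₁ / 2) / (cauchyQ x₁ x₂ * cauchyQuad x₁ x₂ 0))) +
      ((4 : ℝ) : ℂ) * ((Real.pi / 2 - Complex.arctan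
          (-Complex.I * (x₁ - 2 * x₂) / cauchyRoot x₁ x₂)) /
            (cauchyQ x₁ x₂ * cauchyRoot x₁ x₂)) := by
    rw [← arctan_sub_arctan_eq, cauchyPrimitive, cauchyPrimitive, e1, e0]
    push_cast
    ring
  rw [hsplit, Complex.add_re, re_rational_part, Complex.re_ofReal_mul]
  field_simp
  ring

lemma IsCauchyMotion.integrable_charFun_map_toLp (hL : IsCauchyMotion P L)
    (h₁ : IsStochIntegral P L 0 1 (fun _ => 1) X₁)
    (h₂ : IsStochIntegral P L 0 1 (fun z => z) X₂) :
    Integrable (charFun (P.map (fun ω => WithLp.toLp 2 (X₁ ω, X₂ ω)))) := by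
  rw [funext (hL.charFun_map_toLp h₁ h₂)]
  exact integrable_cexp_neg_affineNorm

lemma IsCauchyMotion.hasLaw_prodMk (hL : IsCauchyMotion P L)
    (h₁ : IsStochIntegral P L 0 1 (fun _ => 1) X₁)
    (h₂ : IsStochIntegral P L 0 1 (fun z => z) X₂) :
    HasLaw (fun ω => (X₁ ω, X₂ ω)) ((volume : Measure (ℝ × ℝ)).withDensity fun x =>
      ENNReal.ofReal (charDensity (P.map (fun ω => WithLp.toLp 2 (X₁ ω, X₂ ω)))
        (WithLp.toLp 2 x)).re) P := by
  have hm := h₁.1.prodMk h₂.1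
  have hT : Measurable (WithLp.toLp 2 : ℝ × ℝ → WithLp 2 (ℝ × ℝ)) :=
    WithLp.measurable_toLp 2 (ℝ × ℝ)
  have hO : Measurable (WithLp.ofLp : WithLp 2 (ℝ × ℝ) → ℝ × ℝ) := WithLp.measurable_ofLp 2 (ℝ × ℝ)
  refine ⟨hm, ?_⟩
  set μ := P.map (fun ω => WithLp.toLp 2 (X₁ ω, X₂ ω)) with hμ
  have : IsProbabilityMeasure μ := Measure.isProbabilityMeasure_map (hT.comp_aemeasurable hm)
  have hi := hL.integrable_charFun_map_toLp h₁ h₂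
  have hg : Measurable (fun x => ENNReal.ofReal (charDensity μ x).re) := by
    have := (continuous_charDensity hi).measurable
    fun_prop
  have e : P.map (fun ω => (X₁ ω, X₂ ω)) = μ.map WithLp.ofLp := by
    have hTm : AEMeasurable (fun ω => WithLp.toLp 2 (X₁ ω, X₂ ω)) P := hT.comp_aemeasurable hm
    rw [hμ, AEMeasurable.map_map_of_aemeasurable hO.aemeasurable hTm]
    rfl
  rw [e]
  refine Measure.ext fun s hs => ?_
  have hd := eq_withDensity_charDensity hi
  rw [← hμ] at hd
  rw [Measure.map_apply hO hs, withDensity_apply _ hs]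
  conv_lhs => rw [hd]
  rw [withDensity_apply _ (hO hs),
    ← (WithLp.volume_preserving_toLp (U := ℝ) (V := ℝ)).setLIntegral_comp_preimage (hO hs) hg]
  rfl

end JointLaw

/-- The complex powers are principal values and `Complex.arctan` is the principal inverse tangent;
the arguments that occur lie off its branch cuts. Since `f` is continuous, its values on the null
line `x₁ = 2 x₂` are determined by the law. -/
theorem theorem4p2 {Ω : Type*} [MeasurableSpace Ω] (P : Measure Ω) [IsProbabilityMeasure P]
    (L : ℝ → Ω → ℝ) (hL : IsCauchyMotion P L) :
    (∃ X₁ X₂ : Ω → ℝ,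
      IsStochIntegral P L 0 1 (fun _ => 1) X₁ ∧ IsStochIntegral P L 0 1 (fun z => z) X₂) ∧
    ∃ f : ℝ × ℝ → ℝ,
      Continuous f ∧ (∀ x, 0 ≤ f x) ∧
      (∀ X₁ X₂ : Ω → ℝ,
        IsStochIntegral P L 0 1 (fun _ => 1) X₁ → IsStochIntegral P L 0 1 (fun z => z) X₂ →
        HasLaw (fun ω => (X₁ ω, X₂ ω))
          ((volume : Measure (ℝ × ℝ)).withDensity (fun x => ENNReal.ofReal (f x))) P) ∧
      (∀ x₁ x₂ : ℝ, x₁ ≠ 2 * x₂ →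
        f (x₁, x₂) =
          (4 / Real.pi ^ 2) / (1 + 6 * x₁ ^ 2 + x₁ ^ 4 - 16 * x₁ * x₂ + 16 * x₂ ^ 2) +
          (2 / Real.pi ^ 2) *
            (Complex.arctan
                (Complex.I * cauchyQ x₁ x₂ ^ (1 / 2 : ℂ) / ((x₁ : ℂ) - 2 * (x₂ : ℂ))) /
              cauchyQ x₁ x₂ ^ (3 / 2 : ℂ)).re) ∧
      (∀ x₁ x₂ : ℝ, x₁ = 2 * x₂ →
        f (x₁, x₂) =
          (4 / Real.pi ^ 2) / (1 + x₁ ^ 2) ^ 2 +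
          1 / (Real.pi * (1 + x₁ ^ 2) ^ (3 / 2 : ℝ))) := by
  obtain ⟨Y₁, h₁⟩ := hL.exists_isStochIntegral_one
  obtain ⟨Y₂, h₂⟩ := hL.exists_isStochIntegral_id
  have hT : Measurable (WithLp.toLp 2 : ℝ × ℝ → WithLp 2 (ℝ × ℝ)) :=
    WithLp.measurable_toLp 2 (ℝ × ℝ)
  have prob : ∀ X₁ X₂ : Ω → ℝ, IsStochIntegral P L 0 1 (fun _ => 1) X₁ →
      IsStochIntegral P L 0 1 (fun z => z) X₂ →
      IsProbabilityMeasure (P.map (fun ω => WithLp.toLp 2 (X₁ ω, X₂ ω))) := fun X₁ X₂ k₁ k₂ =>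
    Measure.isProbabilityMeasure_map (hT.comp_aemeasurable (k₁.1.prodMk k₂.1))
  set μ := P.map (fun ω => WithLp.toLp 2 (Y₁ ω, Y₂ ω)) with hμ
  have hμp : IsProbabilityMeasure μ := prob Y₁ Y₂ h₁ h₂
  have hi : Integrable (charFun μ) := hL.integrable_charFun_map_toLp h₁ h₂
  refine ⟨⟨Y₁, Y₂, h₁, h₂⟩, fun x => (charDensity μ (WithLp.toLp 2 x)).re, ?_, ?_, ?_, ?_, ?_⟩
  · exact Complex.continuous_re.comp ((continuous_charDensity hi).comp
      (WithLp.prod_continuous_toLp 2 ℝ ℝ))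
  · exact fun x => re_charDensity_nonneg hi _
  · intro X₁ X₂ k₁ k₂
    have := prob X₁ X₂ k₁ k₂
    -- The density is built from one pair `(Y₁, Y₂)`; every other version has the same
    -- characteristic function, hence the same law.
    have e : P.map (fun ω => WithLp.toLp 2 (X₁ ω, X₂ ω)) = μ :=
      Measure.ext_of_charFun (funext fun t => by
        rw [hL.charFun_map_toLp k₁ k₂, hL.charFun_map_toLp h₁ h₂])
    have h := hL.hasLaw_prodMk k₁ k₂
    rwa [e] at h
  · intro x₁ x₂ hx
    obtain ⟨z1, z2, -⟩ := arctan_arg_mem_slitPlane (arctan_cut_zeta x₁ x₂)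
    beta_reduce
    rw [hL.re_charDensity_map_toLp h₁ h₂, ← arctan_inv_of_re_pos (re_zeta_pos hx) z1 z2,
      cauchyQ_cpow_three_halves, ← cauchyRoot]
    -- It remains to see that `i √Q / (x₁ - 2 x₂)` is the inverse of `-i (x₁ - 2 x₂) / √Q`.
    congr 5
    have hc : (x₁ : ℂ) - 2 * x₂ ≠ 0 := by
      exact_mod_cast sub_ne_zero.2 hx
    have hR := cauchyRoot_ne_zero x₁ x₂
    rw [inv_div, div_eq_div_iff (mul_ne_zero (neg_ne_zero.2 Complex.I_ne_zero) hc) hc]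
    linear_combination (cauchyRoot x₁ x₂ * ((x₁ : ℂ) - 2 * x₂)) * Complex.I_sq
  · rintro x₁ x₂ rfl
    have hπ := Real.pi_pos
    beta_reduce
    rw [hL.re_charDensity_map_toLp h₁ h₂, ← cauchyQ_cpow_three_halves]
    have hQ : cauchyQ (2 * x₂) x₂ = ((1 + (2 * x₂) ^ 2 : ℝ) : ℂ) := by
      rw [cauchyQ]; push_cast; ring
    have hz : (-Complex.I * (((2 * x₂ : ℝ) : ℂ) - 2 * x₂) / cauchyRoot (2 * x₂) x₂) = 0 := by
      push_cast; simp
    have ha : Complex.arctan 0 = 0 := by simp [Complex.arctan]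
    have hp : (((1 + (2 * x₂) ^ 2 : ℝ) : ℂ)) ^ (3 / 2 : ℂ) =
        (((1 + (2 * x₂) ^ 2) ^ (3 / 2 : ℝ) : ℝ) : ℂ) := by
      rw [Complex.ofReal_cpow (by positivity)]; norm_num
    rw [hz, ha, hQ, hp, sub_zero]
    have hr : ((Real.pi / 2 : ℂ) / (((1 + (2 * x₂) ^ 2) ^ (3 / 2 : ℝ) : ℝ) : ℂ)) =
        ((Real.pi / 2 / (1 + (2 * x₂) ^ 2) ^ (3 / 2 : ℝ) : ℝ) : ℂ) := by push_cast; ring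
    rw [hr, Complex.ofReal_re]
    congr 1
    · congr 1; ring
    · have : 0 < (1 + (2 * x₂) ^ 2) ^ (3 / 2 : ℝ) := by positivity
      field_simp
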